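/- Let $\mathcal{A}(n)$ be the Arnold algebra over $\mathbb{Q}$: the quotient of the exterior algebra on degree-one generators $w_{ij}=w_{ji}$ ($1\le i<j\le n$) by the two-sided ideal generated by $w_{ij}w_{ik}-w_{ij}w_{jk}+w_{ik}w_{jk}$ ($1\le i<j<k\le n$), with the action $\pi\cdot w_{ij}=w_{\pi(i)\pi(j)}$ of the symmetric group $\mathcal{S}_n$, and let $\mathcal{A}^1(n)$ be its degree-one component. Let $L\mathcal{P}_2(n)$ be the $\mathbb{Q}$-span of the two-element subsets of $\{1,\dots,n\}$ with the natural $\mathcal{S}_n$-action. Let $V_\lambda$ be the irreducible rational $\mathcal{S}_n$-module (Specht module, the span of the polytabloids of shape $\lambda$) of the partition $\lambda$ of $n$, and for $n\ge 2k$ put $V(k)_n=V_{(n-k,k)}$, with $V(0)_n=V_{(n)}$. In $\mathcal{A}^1(n)$ put $$\Omega^n=\sum_{i<j}w_{ij},\qquad \Omega^n_{ij}=\sum_{k\ne i,j}(w_{ik}-w_{jk}),\qquad \Omega_{ijkl}=w_{il}-w_{ik}+w_{jk}-w_{jl}.$$ **Proposition 6.2.** For every $n$, $w_{ij}\mapsto\{i,j\}$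 defines an isomorphism of $\mathcal{S}_n$-modules $\mathcal{A}^1(n)\cong L\mathcal{P}_2(n)$. For $n\ge4$, $\mathcal{A}^1(n)$ is the (internal) direct sum of three irreducible $\mathcal{S}_n$-submodules isomorphic to $V(0)_n$, $V(1)_n$ and $V(2)_n$: $$\mathcal{A}^1(n)=V(0)_n\oplus V(1)_n\oplus V(2)_n,$$ and bases of these three components are, respectively, $$\begin{aligned}\mathcal{B}(n)&=\{\Omega^n\},\\ \mathcal{B}(n-1,1)&=\{\Omega^n_{1j}\mid 2\le j\le n\},\\ \mathcal{B}(n-2,2)&=\{\Omega_{123j}\mid 4\le j\le n\}\cup\{\Omega_{1i2j}\mid 3\le i<j\le n\}.\end{aligned}$$ In the unstable cases, $\mathcal{A}^1(2)=V_{(2)}$, with basis $\{\Omega^2\}$, and $\mathcal{A}^1(3)=V_{(3)}\oplus V_{(2,1)}$ as an internal direct sum of irreducible submodules, with bases $\{\Omega^3\}$ of the first and $\{\Omega^3_{12},\Omega^3_{13}\}$ of the second component. -/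

import Mathlib

noncomputable section

namespace Arnold

open Equiv

/-! ### The linearised set of `k`-subsets -/

/-- The `S_n`-module `L P_k(n)`: the rational span of the set of `k`-element subsets of an
`n`-element set, with `π · A = π(A)`. -/
abbrev LP (n k : ℕ) :
    Representation ℚ (Perm (Fin n)) (MonoidAlgebra ℚ (Set.powersetCard (Fin n) k)) :=
  Representation.ofMulAction ℚ (Perm (Fin n)) (Set.powersetCard (Fin n) k)

/-- The two-element subset `{i, j}`. -/
def pair {n : ℕ} (i j : Fin n) (h : i ≠ j) : Set.powersetCard (Fin n) 2 :=
  ⟨{i, j}, Finset.card_pair h⟩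

/-! ### The irreducible modules `V_λ` (Specht modules) -/

/-- Young tableaux of shape `μ` with entries `1, …, n` (each used once). -/
abbrev Tableau (n : ℕ) (μ : YoungDiagram) : Type := {c : ℕ × ℕ // c ∈ μ.cells} ≃ Fin n

/-- The permutations of the entries that preserve every column of `t`. -/
def columnStabilizer {n : ℕ} {μ : YoungDiagram} (t : Tableau n μ) : Finset (Perm (Fin n)) :=
  Finset.univ.filter fun π => ∀ x, (t.symm (π x)).1.2 = (t.symm x).1.2

/-- The tabloid `{t}` (the row equivalence class of `t`), recorded by the function that sends
each entry to the index of its row: two tableaux of shape `μ` are row equivalent exactly when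
these functions agree. -/
def tabloid {n : ℕ} {μ : YoungDiagram} (t : Tableau n μ) : Fin n → ℕ :=
  fun x => (t.symm x).1.1

/-- The permutation representation of `S_n` on the span of all functions from entries to row
indices; on tabloids it is the usual action `π · {t} = {π t}`. -/
def rowRep (n : ℕ) : Representation ℚ (Perm (Fin n)) ((Fin n → ℕ) →₀ ℚ) where
  toFun π := Finsupp.lmapDomain ℚ ℚ fun r x => r (π⁻¹ x)
  map_one' := by ext; simp
  map_mul' σ π := by ext; simp

/-- The polytabloid `e_t = ∑_{π ∈ C_t} sgn(π) {π t}`. -/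
def polytabloid {n : ℕ} {μ : YoungDiagram} (t : Tableau n μ) : (Fin n → ℕ) →₀ ℚ :=
  ∑ π ∈ columnStabilizer t, Finsupp.single (tabloid (t.trans π)) ((Perm.sign π : ℤ) : ℚ)

theorem rowRep_polytabloid {n : ℕ} {μ : YoungDiagram} (σ : Perm (Fin n)) (t : Tableau n μ) :
    rowRep n σ (polytabloid t) = polytabloid (t.trans σ) := by
  unfold polytabloid
  rw [map_sum]
  refine Finset.sum_equiv (MulAut.conj σ).toEquiv ?_ ?_
  · intro π
    simp only [columnStabilizer, Finset.mem_filter, Finset.mem_univ, true_and]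
    constructor
    · intro h x
      simpa using h (σ⁻¹ x)
    · intro h x
      simpa using h (σ x)
  · intro π _
    simp only [rowRep, MonoidHom.coe_mk, OneHom.coe_mk, Finsupp.lmapDomain_apply,
      Finsupp.mapDomain_single]
    congr 1
    · funext x
      change _ = (t.symm (σ.symm ((σ * π * σ⁻¹)⁻¹ x))).1.1
      rw [mul_inv_rev, mul_inv_rev, inv_inv]
      simp [tabloid]
    · have h : Perm.sign (σ * π * σ⁻¹) = Perm.sign π := by
        rw [Perm.sign_mul, Perm.sign_mul, Perm.sign_inv, mul_right_comm, Int.units_mul_self,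
          one_mul]
      exact congrArg (fun u : ℤˣ => ((u : ℤ) : ℚ)) h.symm

/-- The Specht module `V_μ`, for a Young diagram `μ` with `n` cells: the span of the polytabloids
of shape `μ` in the permutation module on tabloids. -/
def specht (n : ℕ) (μ : YoungDiagram) : Subrepresentation (rowRep n) where
  toSubmodule := Submodule.span ℚ (Set.range (polytabloid (n := n) (μ := μ)))
  apply_mem_toSubmodule σ v hv := by
    induction hv using Submodule.span_induction with
    | mem x hx =>
      obtain ⟨t, rfl⟩ := hx
      rw [rowRep_polytabloid]
      exact Submodule.subset_span ⟨_, rfl⟩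
    | zero => rw [map_zero]; exact Submodule.zero_mem _
    | add x y _ _ hx hy => rw [map_add]; exact Submodule.add_mem _ hx hy
    | smul a x _ hx => rw [map_smul]; exact Submodule.smul_mem _ a hx

/-- The Young diagram of the partition `(n - k, k)`, where `2 k ≤ n`; for `k = 0` this is the
one-row diagram `(n)`. -/
def twoRow (n k : ℕ) (h : 2 * k ≤ n) : YoungDiagram :=
  YoungDiagram.ofRowLens [n - k, k] (by
    rw [List.sortedGE_iff_pairwise]
    simp
    omega)

/-- `V_{(n - k, k)}` as a representation of `S_n`; in stable notation `V(k)_n`. -/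
def V (n k : ℕ) (h : 2 * k ≤ n) :
    Representation ℚ (Perm (Fin n)) (specht n (twoRow n k h)).toSubmodule :=
  (specht n (twoRow n k h)).toRepresentation

/-! ### The Arnold algebra -/

/-- The rational vector space with basis `w_{ij} = w_{ji}`, indexed by the subsets `{i, j}`. -/
abbrev Gen (n : ℕ) : Type := Set.powersetCard (Fin n) 2 →₀ ℚ

/-- The free graded commutative algebra `Λ^*(w_{ij})` on generators `w_{ij}` of degree one. -/
abbrev Ext (n : ℕ) : Type := ExteriorAlgebra ℚ (Gen n)

/-- The generator `w_{ij}` of the exterior algebra, for `i ≠ j` (by convention `0` if `i = j`). -/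
def wExt {n : ℕ} (i j : Fin n) : Ext n :=
  if h : i ≠ j then ExteriorAlgebra.ι ℚ (Finsupp.single (pair i j h) 1) else 0

/-- The Yang–Baxter element `w_{ij} w_{ik} - w_{ij} w_{jk} + w_{ik} w_{jk}`. -/
def YB {n : ℕ} (i j k : Fin n) : Ext n :=
  wExt i j * wExt i k - wExt i j * wExt j k + wExt i k * wExt j k

/-- The defining relations `YB_{ijk} = 0` for `i < j < k`. -/
inductive YBRel (n : ℕ) : Ext n → Ext n → Prop
  | of (i j k : Fin n) (hij : i < j) (hjk : j < k) : YBRel n (YB i j k) 0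

/-- The Arnold algebra `A_n`: the quotient of the exterior algebra by the two-sided ideal
generated by the Yang–Baxter elements. -/
abbrev ArnoldAlgebra (n : ℕ) : Type := RingQuot (YBRel n)

/-- The quotient map onto the Arnold algebra. -/
abbrev toArnold (n : ℕ) : Ext n →ₐ[ℚ] ArnoldAlgebra n := RingQuot.mkAlgHom ℚ (YBRel n)

theorem pair_comm {n : ℕ} (i j : Fin n) (h : i ≠ j) : pair i j h = pair j i h.symm :=
  Subtype.ext (Finset.pair_comm i j)

theorem wExt_comm {n : ℕ} (i j : Fin n) : wExt i j = wExt j i := by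
  by_cases h : i = j
  · rw [h]
  · rw [wExt, wExt, dif_pos h, dif_pos (Ne.symm h), pair_comm]

theorem wExt_anticomm {n : ℕ} (i j k l : Fin n) :
    wExt i j * wExt k l = -(wExt k l * wExt i j) := by
  by_cases h : i = j
  · simp [wExt, h]
  by_cases h' : k = l
  · simp [wExt, h']
  rw [wExt, wExt, dif_pos h, dif_pos h', eq_neg_iff_add_eq_zero]
  exact ExteriorAlgebra.ι_add_mul_swap _ _

theorem YB_swap_left {n : ℕ} (i j k : Fin n) : YB j i k = -YB i j k := by
  rw [YB, YB, wExt_comm j i, wExt_anticomm j k i k]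
  abel

theorem YB_swap_right {n : ℕ} (i j k : Fin n) : YB i k j = -YB i j k := by
  rw [YB, YB, wExt_comm k j, wExt_anticomm i k i j]
  abel

/-- The relations are invariant up to sign under reordering of the three indices. -/
theorem toArnold_YB {n : ℕ} (i j k : Fin n) (hij : i ≠ j) (hik : i ≠ k) (hjk : j ≠ k) :
    toArnold n (YB i j k) = 0 := by
  have key : ∀ a b c : Fin n, a < b → b < c → toArnold n (YB a b c) = 0 := fun a b c h h' => by
    simpa using RingQuot.mkAlgHom_rel ℚ (YBRel.of a b c h h')
  have sl : ∀ a b c : Fin n, toArnold n (YB a b c) = 0 → toArnold n (YB b a c) = 0 :=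
    fun a b c h => by rw [YB_swap_left, map_neg, h, neg_zero]
  have sr : ∀ a b c : Fin n, toArnold n (YB a b c) = 0 → toArnold n (YB a c b) = 0 :=
    fun a b c h => by rw [YB_swap_right, map_neg, h, neg_zero]
  rcases lt_or_gt_of_ne hij with h1 | h1 <;> rcases lt_or_gt_of_ne hik with h2 | h2 <;>
    rcases lt_or_gt_of_ne hjk with h3 | h3
  · exact key _ _ _ h1 h3
  · exact sr _ _ _ (key _ _ _ h2 h3)
  · exact absurd (h1.trans h3) (not_lt.mpr h2.le)
  · exact sr _ _ _ (sl _ _ _ (key _ _ _ h2 h1))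
  · exact sl _ _ _ (key _ _ _ h1 h2)
  · exact absurd (h3.trans h1) (not_lt.mpr h2.le)
  · exact sl _ _ _ (sr _ _ _ (key _ _ _ h3 h2))
  · exact sl _ _ _ (sr _ _ _ (sl _ _ _ (key _ _ _ h3 h1)))

/-- The action of a permutation on the exterior algebra, `π · w_{ij} = w_{π(i)π(j)}`. -/
def actExt {n : ℕ} (π : Perm (Fin n)) : Ext n →ₐ[ℚ] Ext n :=
  ExteriorAlgebra.map (Finsupp.lmapDomain ℚ ℚ fun A => π • A)

theorem smul_pair {n : ℕ} (π : Perm (Fin n)) (i j : Fin n) (h : i ≠ j) :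
    π • pair i j h = pair (π i) (π j) (π.injective.ne h) := by
  apply Subtype.ext
  simp [pair, Finset.smul_finset_def, Finset.image_insert]

theorem actExt_wExt {n : ℕ} (π : Perm (Fin n)) (i j : Fin n) :
    actExt π (wExt i j) = wExt (π i) (π j) := by
  by_cases h : i = j
  · simp [wExt, h]
  · rw [wExt, wExt, dif_pos h, dif_pos (π.injective.ne h), actExt, ExteriorAlgebra.map_apply_ι]
    simp [smul_pair]

theorem actExt_YB {n : ℕ} (π : Perm (Fin n)) (i j k : Fin n) :
    actExt π (YB i j k) = YB (π i) (π j) (π k) := by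
  simp [YB, actExt_wExt]

/-- The induced action of a permutation on the Arnold algebra by algebra endomorphisms. -/
def act {n : ℕ} (π : Perm (Fin n)) : ArnoldAlgebra n →ₐ[ℚ] ArnoldAlgebra n :=
  RingQuot.liftAlgHom ℚ ⟨(toArnold n).comp (actExt π), by
    rintro _ _ ⟨i, j, k, hij, hjk⟩
    rw [AlgHom.comp_apply, actExt_YB, map_zero]
    exact toArnold_YB _ _ _ (π.injective.ne hij.ne) (π.injective.ne (hij.trans hjk).ne)
      (π.injective.ne hjk.ne)⟩

theorem act_toArnold {n : ℕ} (π : Perm (Fin n)) (x : Ext n) :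
    act π (toArnold n x) = toArnold n (actExt π x) := by
  rw [act, RingQuot.liftAlgHom_mkAlgHom_apply, AlgHom.comp_apply]

theorem actExt_one {n : ℕ} (x : Ext n) : actExt 1 x = x := by
  have h : (Finsupp.lmapDomain ℚ ℚ fun A : Set.powersetCard (Fin n) 2 => (1 : Perm (Fin n)) • A)
      = LinearMap.id := by ext; simp
  rw [actExt, h, ExteriorAlgebra.map_id, AlgHom.id_apply]

theorem actExt_mul {n : ℕ} (σ π : Perm (Fin n)) (x : Ext n) :
    actExt (σ * π) x = actExt σ (actExt π x) := by
  rw [actExt, actExt, actExt, ← AlgHom.comp_apply, ExteriorAlgebra.map_comp_map]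
  congr 2
  ext
  simp [mul_smul]

/-- The representation of `S_n` on the Arnold algebra. -/
def arnoldRep (n : ℕ) : Representation ℚ (Perm (Fin n)) (ArnoldAlgebra n) where
  toFun π := (act π).toLinearMap
  map_one' := by
    ext x
    obtain ⟨y, rfl⟩ := RingQuot.mkAlgHom_surjective ℚ (YBRel n) x
    rw [AlgHom.toLinearMap_apply, act_toArnold, actExt_one, Module.End.one_apply]
  map_mul' σ π := by
    ext x
    obtain ⟨y, rfl⟩ := RingQuot.mkAlgHom_surjective ℚ (YBRel n) x
    rw [AlgHom.toLinearMap_apply, act_toArnold, actExt_mul, Module.End.mul_apply,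
      AlgHom.toLinearMap_apply, AlgHom.toLinearMap_apply, act_toArnold, act_toArnold]

/-- The homogeneous component `A^d(n)` of the Arnold algebra, as an `S_n`-submodule: the image of
the degree `d` part of the exterior algebra. -/
def component (n d : ℕ) : Subrepresentation (arnoldRep n) where
  toSubmodule := (⋀[ℚ]^d (Gen n)).map (toArnold n).toLinearMap
  apply_mem_toSubmodule π v hv := by
    obtain ⟨x, hx, rfl⟩ := hv
    refine ⟨actExt π x, ?_, (act_toArnold π x).symm⟩
    have h : (⋀[ℚ]^d (Gen n)).map (actExt π).toLinearMap ≤ ⋀[ℚ]^d (Gen n) := by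
      rw [ExteriorAlgebra.exteriorPower, Submodule.map_pow]
      refine pow_le_pow_left' ?_ d
      rintro _ ⟨_, ⟨m, rfl⟩, rfl⟩
      exact ⟨_, (ExteriorAlgebra.map_apply_ι _ m).symm⟩
    exact h ⟨x, hx, rfl⟩

/-- The underlying vector space of the degree one component `A^1(n)`. -/
abbrev A1 (n : ℕ) : Type := (component n 1).toSubmodule

/-- The `S_n`-module `A^1(n)`. -/
abbrev A1rep (n : ℕ) : Representation ℚ (Perm (Fin n)) (A1 n) := (component n 1).toRepresentation

/-- The class of `w_{ij}` in `A^1(n)`. -/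
def w {n : ℕ} (i j : Fin n) : A1 n :=
  ⟨toArnold n (wExt i j), wExt i j, by
    rw [ExteriorAlgebra.exteriorPower, pow_one, wExt]
    split_ifs
    · exact ⟨_, rfl⟩
    · exact Submodule.zero_mem _, rfl⟩

/-- `Ω^n = ∑_{i < j} w_{ij}`. -/
def Omega (n : ℕ) : A1 n := ∑ i : Fin n, ∑ j ∈ Finset.univ.filter (fun j => i < j), w i j

/-- `Ω^n_{ij} = ∑_{k ≠ i, j} (w_{ik} - w_{jk})`. -/
def Omega₂ {n : ℕ} (i j : Fin n) : A1 n :=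
  ∑ k ∈ Finset.univ.filter (fun k => k ≠ i ∧ k ≠ j), (w i k - w j k)

/-- `Ω_{ijkl} = w_{il} - w_{ik} + w_{jk} - w_{jl}`. -/
def Omega₄ {n : ℕ} (i j k l : Fin n) : A1 n := w i l - w i k + w j k - w j l

/-! The three families below; the elements `1, 2, …, n` of the text are `0, 1, …, n - 1` here. -/

/-- `B(n) = {Ω^n}`. -/
def B0 (n : ℕ) : Unit → A1 n := fun _ => Omega n

/-- `B(n-1,1) = {Ω^n_{12}, Ω^n_{13}, …, Ω^n_{1n}}`. -/
def B1 (n : ℕ) [NeZero n] : {j : Fin n // j ≠ 0} → A1 n := fun j => Omega₂ 0 j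

/-- `B(n-2,2)`: the `Ω_{123j}` with `4 ≤ j ≤ n` and the `Ω_{1i2j}` with `3 ≤ i < j ≤ n`. -/
def B2 (n : ℕ) [NeZero n] :
    {j : Fin n // 3 ≤ (j : ℕ)} ⊕ {p : Fin n × Fin n // 2 ≤ (p.1 : ℕ) ∧ p.1 < p.2} → A1 n :=
  Sum.elim (fun j => Omega₄ 0 1 2 j) (fun p => Omega₄ 0 p.1.1 1 p.1.2)

/-- The family `b` is a basis of the subspace `U`. -/
def IsBasisOf {ι M : Type*} [AddCommGroup M] [Module ℚ M] (b : ι → M) (U : Submodule ℚ M) : Prop :=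
  LinearIndependent ℚ b ∧ Submodule.span ℚ (Set.range b) = U

/-- The subrepresentation `U` is irreducible and isomorphic to `σ`. -/
def IsCopyOf {G M N : Type*} [Group G] [AddCommGroup M] [Module ℚ M] [AddCommGroup N] [Module ℚ N]
    {ρ : Representation ℚ G M} (U : Subrepresentation ρ) (σ : Representation ℚ G N) : Prop :=
  U.toRepresentation.IsIrreducible ∧ Nonempty (U.toRepresentation.Equiv σ)

end Arnold

end

noncomputable section

namespace Arnold

open Equiv

/-! ### The degree one component -/

/-! The defining relations are quadratic, so they impose nothing in degree one: `linearPart`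
recovers a linear form from its class, and `A1 n` is free on the `w i j`. An element is thus a
symmetric matrix with zero diagonal, read through `entry`.

Two equivariant maps organise everything: `rowSum`, from `A1 n` to ℚ^n, and `star` in the other
direction. By `rowSum_star`, the composite on ℚ^n is (n - 2) times the identity plus the all-ones
matrix, which is invertible for n ≥ 3. Hence `A1 n` is the image of `star` plus the kernel `U₂` of
`rowSum`. Splitting ℚ^n into constants and vectors of sum zero splits that image into `U₀` and `U₁`.

The families `B0` and `B1` are, up to scalars, `star` of standard bases. For `B2`, a suitable set of
coordinates determines an element of `U₂` and is triangular on the family (`entry_B2_of_two_le`,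
`entry_zero_B2_inl`, `eq_zero_of_entry_eq_zero`).

For irreducibility of `U₁` and `U₂`, antisymmetrising a nonzero vector over one or two disjoint
transpositions gives a nonzero multiple of some `Omega₂` or `Omega₄`, and the orbit of such an
element spans the component. For `U₂`, positive definiteness of `pairing` guarantees that some
antisymmetrisation is nonzero.

The polytabloids of shapes (n), (n-1,1) and (n-2,2) are computed explicitly. Equivariant maps to
tabloids send the generators of each component to multiples of them, which identifies the components
with Specht modules. -/

/-- The linear part of an element of the exterior algebra, as an algebra map to the square-zero
extension `ℚ ⊕ Gen n`. -/
def linearPartExt (n : ℕ) : Ext n →ₐ[ℚ] TrivSqZeroExt ℚ (Gen n) :=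
  ExteriorAlgebra.lift ℚ ⟨TrivSqZeroExt.inrHom ℚ (Gen n), fun m => by
    simp [TrivSqZeroExt.inr_mul_inr]⟩

theorem linearPartExt_ι {n : ℕ} (m : Gen n) :
    linearPartExt n (ExteriorAlgebra.ι ℚ m) = TrivSqZeroExt.inr m := by
  simp [linearPartExt]

/-- Degree-one elements multiply to zero in a square-zero extension, so the Yang–Baxter relations
hold there automatically and the map descends to the quotient. -/
theorem linearPartExt_wExt_mul_wExt {n : ℕ} (i j k l : Fin n) :
    linearPartExt n (wExt i j * wExt k l) = 0 := by
  rw [map_mul, wExt, wExt]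
  split_ifs <;> simp [linearPartExt_ι, TrivSqZeroExt.inr_mul_inr]

/-- The algebra map `A(n) → ℚ ⊕ Gen n` with `w_{ij} ↦ (0, w_{ij})`. -/
def linearPart (n : ℕ) : ArnoldAlgebra n →ₐ[ℚ] TrivSqZeroExt ℚ (Gen n) :=
  RingQuot.liftAlgHom ℚ ⟨linearPartExt n, by
    rintro _ _ ⟨i, j, k, _, _⟩
    simp [YB, linearPartExt_wExt_mul_wExt]⟩

theorem linearPart_toArnold {n : ℕ} (x : Ext n) :
    linearPart n (toArnold n x) = linearPartExt n x := by
  rw [linearPart, RingQuot.liftAlgHom_mkAlgHom_apply]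

theorem mem_component_one {n : ℕ} (v : ArnoldAlgebra n) :
    v ∈ (component n 1).toSubmodule ↔ ∃ m : Gen n, toArnold n (ExteriorAlgebra.ι ℚ m) = v := by
  change v ∈ (⋀[ℚ]^1 (Gen n)).map (toArnold n).toLinearMap ↔ _
  rw [ExteriorAlgebra.exteriorPower, pow_one]
  simp

/-- The degree one component of the Arnold algebra is freely spanned by the `w_{ij}`. -/
def genEquiv (n : ℕ) : A1 n ≃ₗ[ℚ] Gen n :=
  LinearEquiv.symm <| LinearEquiv.ofBijective
    (LinearMap.codRestrict (component n 1).toSubmodule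
      ((toArnold n).toLinearMap ∘ₗ ExteriorAlgebra.ι ℚ)
      fun m => (mem_component_one _).2 ⟨m, rfl⟩) <| by
    constructor
    -- The linear part is a left inverse of the passage to the quotient.
    · intro x y h
      have h' : toArnold n (ExteriorAlgebra.ι ℚ x) = toArnold n (ExteriorAlgebra.ι ℚ y) :=
        congrArg Subtype.val h
      have := congrArg (linearPart n) h'
      rw [linearPart_toArnold, linearPart_toArnold, linearPartExt_ι, linearPartExt_ι] at this
      exact TrivSqZeroExt.inr_injective this
    · rintro ⟨v, hv⟩
      obtain ⟨m, rfl⟩ := (mem_component_one v).1 hv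
      exact ⟨m, rfl⟩

theorem genEquiv_symm_single {n : ℕ} (i j : Fin n) (h : i ≠ j) :
    (genEquiv n).symm (Finsupp.single (pair i j h) 1) = w i j := by
  apply Subtype.ext
  simp only [w, wExt, dif_pos h]
  rfl

theorem genEquiv_w {n : ℕ} (i j : Fin n) (h : i ≠ j) :
    genEquiv n (w i j) = Finsupp.single (pair i j h) 1 := by
  rw [← genEquiv_symm_single i j h, LinearEquiv.apply_symm_apply]

@[simp]
theorem w_self {n : ℕ} (i : Fin n) : w i i = 0 := by
  apply Subtype.ext
  simp [w, wExt]

theorem w_comm {n : ℕ} (i j : Fin n) : w i j = w j i := by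
  apply Subtype.ext
  simp [w, wExt_comm i j]

@[simp]
theorem A1rep_w {n : ℕ} (π : Perm (Fin n)) (i j : Fin n) :
    A1rep n π (w i j) = w (π i) (π j) := by
  apply Subtype.ext
  change act π (toArnold n (wExt i j)) = toArnold n (wExt (π i) (π j))
  rw [act_toArnold, actExt_wExt]

/-! ### Coordinates with respect to the generators. -/

theorem exists_eq_pair {n : ℕ} (A : Set.powersetCard (Fin n) 2) :
    ∃ (i j : Fin n) (h : i ≠ j), A = pair i j h := by
  obtain ⟨i, j, h, hA⟩ := Finset.card_eq_two.1 A.2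
  exact ⟨i, j, h, Subtype.ext hA⟩

theorem A1_hom_ext {n : ℕ} {N : Type*} [AddCommGroup N] [Module ℚ N] {f g : A1 n →ₗ[ℚ] N}
    (h : ∀ i j : Fin n, i ≠ j → f (w i j) = g (w i j)) : f = g := by
  have : f ∘ₗ (genEquiv n).symm.toLinearMap = g ∘ₗ (genEquiv n).symm.toLinearMap := by
    refine Finsupp.lhom_ext' fun A => LinearMap.ext_ring ?_
    obtain ⟨i, j, hij, rfl⟩ := exists_eq_pair A
    simpa [genEquiv_symm_single] using h i j hij
  ext v
  simpa using LinearMap.congr_fun this (genEquiv n v)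

theorem pair_eq_pair_iff {n : ℕ} {i j x y : Fin n} (h : i ≠ j) (h' : x ≠ y) :
    pair i j h = pair x y h' ↔ x = i ∧ y = j ∨ x = j ∧ y = i := by
  rw [Subtype.ext_iff]
  simp only [pair, ← Finset.coe_inj, Finset.coe_pair, Set.pair_eq_pair_iff]
  tauto

/-- The coefficient of `w_{xy}` in an element of `A^1(n)`; it vanishes for `x = y`. -/
def entry {n : ℕ} (x y : Fin n) : A1 n →ₗ[ℚ] ℚ :=
  if h : x ≠ y then Finsupp.lapply (pair x y h) ∘ₗ (genEquiv n).toLinearMap else 0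

theorem entry_comm {n : ℕ} (x y : Fin n) : entry x y = entry y x := by
  by_cases h : x = y
  · rw [h]
  · rw [entry, entry, dif_pos h, dif_pos (Ne.symm h), pair_comm]

@[simp]
theorem entry_self {n : ℕ} (x : Fin n) (v : A1 n) : entry x x v = 0 := by
  simp [entry]

theorem entry_w {n : ℕ} (x y i j : Fin n) (h : i ≠ j) :
    entry x y (w i j) = if x = i ∧ y = j ∨ x = j ∧ y = i then 1 else 0 := by
  by_cases hxy : x = y
  · subst hxy
    rw [entry_self, if_neg]
    rintro (⟨rfl, h'⟩ | ⟨rfl, h'⟩)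
    exacts [h h', h h'.symm]
  · rw [entry, dif_pos hxy]
    simp [genEquiv_w i j h, Finsupp.single_apply, pair_eq_pair_iff]

/-- The coefficients of `w_{ij}`, with the convention `w_{ii} = 0`. -/
theorem entry_w' {n : ℕ} (x y i j : Fin n) :
    entry x y (w i j) = if i ≠ j ∧ (x = i ∧ y = j ∨ x = j ∧ y = i) then 1 else 0 := by
  by_cases h : i = j
  · simp [h]
  · simp [entry_w x y i j h, h]

theorem A1_ext {n : ℕ} {u v : A1 n} (h : ∀ x y : Fin n, x ≠ y → entry x y u = entry x y v) :
    u = v := by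
  apply (genEquiv n).injective
  ext A
  obtain ⟨i, j, hij, rfl⟩ := exists_eq_pair A
  simpa [entry, hij] using h i j hij

theorem entry_A1rep {n : ℕ} (π : Perm (Fin n)) (x y : Fin n) (v : A1 n) :
    entry x y (A1rep n π v) = entry (π⁻¹ x) (π⁻¹ y) v := by
  have : entry x y ∘ₗ A1rep n π = entry (π⁻¹ x) (π⁻¹ y) := by
    refine A1_hom_ext fun i j h => ?_
    simp [entry_w', Equiv.symm_apply_eq]
  exact LinearMap.congr_fun this v

/-- The linear map on `A^1(n)` with prescribed values on the `w_{ij}`. -/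
def A1lift {n : ℕ} {N : Type*} [AddCommGroup N] [Module ℚ N] (F : Fin n → Fin n → N) :
    A1 n →ₗ[ℚ] N :=
  -- The double sum meets every generator twice, as (i, j) and as (j, i).
  (2⁻¹ : ℚ) • ∑ i, ∑ j, (entry i j).smulRight (F i j)

theorem A1lift_w {n : ℕ} {N : Type*} [AddCommGroup N] [Module ℚ N] (F : Fin n → Fin n → N)
    (hF : ∀ i j, F i j = F j i) (i j : Fin n) (h : i ≠ j) : A1lift F (w i j) = F i j := by
  -- The two orderings of {i, j} are mutually exclusive since i ≠ j, so the indicator is a sum of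
  -- two, each collapsing the double sum to one term.
  have key : ∀ x y, entry x y (w i j) • F x y =
      (if x = i then if y = j then F x y else 0 else 0) +
      (if x = j then if y = i then F x y else 0 else 0) := by
    intro x y
    rw [entry_w x y i j h]
    by_cases h1 : x = i <;> by_cases h2 : y = j <;> by_cases h3 : x = j <;> by_cases h4 : y = i <;>
      subst_vars <;> simp_all
  simp only [A1lift, LinearMap.smul_apply, LinearMap.coe_sum, Finset.sum_apply,
    LinearMap.smulRight_apply, key, Finset.sum_add_distrib]
  simp only [Finset.sum_ite_eq', Finset.sum_ite_irrel, Finset.sum_const_zero, Finset.mem_univ,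
    if_true, hF j i]
  rw [← two_smul ℚ, smul_smul]
  norm_num

/-- `A^1(n) ≅ L P_2(n)`. -/
theorem exists_A1rep_equiv_LP (n : ℕ) :
    ∃ φ : (A1rep n).Equiv (LP n 2),
      ∀ (i j : Fin n) (h : i ≠ j), φ (w i j) = MonoidAlgebra.single (pair i j h) 1 := by
  let e : A1 n ≃ₗ[ℚ] MonoidAlgebra ℚ (Set.powersetCard (Fin n) 2) :=
    (genEquiv n).trans (MonoidAlgebra.coeffLinearEquiv ℚ).symm
  have he : ∀ (i j : Fin n) (h : i ≠ j), e (w i j) = MonoidAlgebra.single (pair i j h) 1 := by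
    intro i j h
    simp [e, genEquiv_w i j h]
  refine ⟨Representation.Equiv.mk e fun π => ?_, he⟩
  refine A1_hom_ext fun i j h => ?_
  simp [he, h, smul_pair]

/-! ### Row sums and stars -/

/-- The map `A^1(n) → ℚ^n`, `w_{ij} ↦ δ_i + δ_j`. -/
def rowSum (n : ℕ) : A1 n →ₗ[ℚ] (Fin n → ℚ) :=
  LinearMap.pi fun i => ∑ y, entry i y

theorem rowSum_apply {n : ℕ} (v : A1 n) (i : Fin n) : rowSum n v i = ∑ y, entry i y v := by
  simp [rowSum]

theorem rowSum_w {n : ℕ} (i j : Fin n) (h : i ≠ j) :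
    rowSum n (w i j) = Pi.single i 1 + Pi.single j 1 := by
  funext x
  have key : ∀ y, entry x y (w i j) =
      (if y = j then if x = i then 1 else 0 else 0) +
      (if y = i then if x = j then 1 else 0 else 0) := by
    intro y
    rw [entry_w x y i j h]
    by_cases h1 : x = i <;> by_cases h2 : y = j <;> by_cases h3 : x = j <;> by_cases h4 : y = i <;>
      subst_vars <;> simp_all
  simp [rowSum_apply, key, Finset.sum_add_distrib, Pi.single_apply]

theorem rowSum_A1rep {n : ℕ} (π : Perm (Fin n)) (v : A1 n) (x : Fin n) :
    rowSum n (A1rep n π v) x = rowSum n v (π⁻¹ x) := by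
  simp only [rowSum_apply, entry_A1rep]
  exact Equiv.sum_comp π⁻¹ fun y => entry (π⁻¹ x) y v

/-- The map `ℚ^n → A^1(n)` with `δ_i ↦ ∑_k w_{ik}`. -/
def star (n : ℕ) : (Fin n → ℚ) →ₗ[ℚ] A1 n :=
  ∑ i, (LinearMap.proj i).smulRight (∑ k, w i k)

theorem star_apply {n : ℕ} (a : Fin n → ℚ) : star n a = ∑ i, a i • ∑ k, w i k := by
  simp [star]

theorem star_single {n : ℕ} (i : Fin n) : star n (Pi.single i 1) = ∑ k, w i k := by
  simp [star_apply, Pi.single_apply]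

theorem entry_star {n : ℕ} (a : Fin n → ℚ) (x y : Fin n) (h : x ≠ y) :
    entry x y (star n a) = a x + a y := by
  have key : ∀ i k : Fin n, entry x y (w i k) =
      (if i = x then if k = y then 1 else 0 else 0) +
      (if i = y then if k = x then 1 else 0 else 0) := by
    intro i k
    rw [entry_w']
    by_cases h1 : i = x <;> by_cases h2 : k = y <;> by_cases h3 : k = x <;> by_cases h4 : i = y <;>
      subst_vars <;> simp_all [eq_comm]
  simp [star_apply, key, mul_add, Finset.sum_add_distrib, Finset.sum_ite_irrel]

theorem A1rep_star {n : ℕ} (π : Perm (Fin n)) (a : Fin n → ℚ) :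
    A1rep n π (star n a) = star n fun x => a (π⁻¹ x) := by
  refine A1_ext fun x y h => ?_
  rw [entry_A1rep, entry_star _ _ _ h, entry_star _ _ _ (π⁻¹.injective.ne h)]

/-- The composite acts as n - 2 on vectors of sum zero and as 2n - 2 on constants. This is what
separates the three components. -/
theorem rowSum_star {n : ℕ} (a : Fin n → ℚ) (x : Fin n) :
    rowSum n (star n a) x = (n - 2) * a x + ∑ i, a i := by
  -- The diagonal entry is 0 rather than a x + a x, hence the correction at y = x.
  have key : ∀ y, entry x y (star n a) = (a x + a y) - if y = x then 2 * a x else 0 := by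
    intro y
    by_cases h : y = x
    · subst h
      simp [two_mul]
    · simp [h, entry_star a x y (Ne.symm h)]
  rw [rowSum_apply]
  simp only [key, Finset.sum_sub_distrib, Finset.sum_add_distrib, Finset.sum_const,
    Finset.card_univ, Fintype.card_fin, Finset.sum_ite_eq', Finset.mem_univ, if_true, nsmul_eq_mul]
  ring

theorem sum_rowSum_star {n : ℕ} (a : Fin n → ℚ) :
    ∑ x, rowSum n (star n a) x = (2 * n - 2) * ∑ i, a i := by
  simp only [rowSum_star, Finset.sum_add_distrib, ← Finset.mul_sum, Finset.sum_const,
    Finset.card_univ, Fintype.card_fin, nsmul_eq_mul]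
  ring

theorem eq_zero_of_rowSum_star_eq_zero {n : ℕ} (hn : 3 ≤ n) {a : Fin n → ℚ}
    (h : rowSum n (star n a) = 0) : a = 0 := by
  have hn' : (3 : ℚ) ≤ n := by exact_mod_cast hn
  have h1 := sum_rowSum_star a
  simp only [h, Pi.zero_apply, Finset.sum_const_zero] at h1
  have h2 : ∑ i, a i = 0 := by
    rcases mul_eq_zero.1 h1.symm with h1 | h1
    · linarith
    · exact h1
  funext x
  have h3 := rowSum_star a x
  rw [h, h2, add_zero] at h3
  rcases mul_eq_zero.1 h3.symm with h3 | h3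
  · linarith
  · exact h3

theorem star_injective {n : ℕ} (hn : 3 ≤ n) : Function.Injective (star n) := by
  rw [← LinearMap.ker_eq_bot, LinearMap.ker_eq_bot']
  exact fun a h => eq_zero_of_rowSum_star_eq_zero hn (by rw [h, map_zero])

theorem exists_rowSum_star_eq {n : ℕ} (hn : 3 ≤ n) (a : Fin n → ℚ) :
    ∃ b, rowSum n (star n b) = a := by
  have hn' : (3 : ℚ) ≤ n := by exact_mod_cast hn
  have h1 : (n : ℚ) - 2 ≠ 0 := by linarith
  have h2 : (n : ℚ) - 1 ≠ 0 := by linarith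
  -- Summing the desired equation over x forces ∑ b = (∑ a) / (2(n - 1)); each coordinate is then
  -- solved for b x.
  refine ⟨fun x => (a x - (∑ i, a i) / (2 * (n - 1))) / (n - 2), ?_⟩
  funext x
  rw [rowSum_star, ← Finset.sum_div, Finset.sum_sub_distrib]
  simp only [Finset.sum_const, Finset.card_univ, Fintype.card_fin, nsmul_eq_mul]
  field_simp
  ring

/-! ### The elements `Ω` -/

/-- In `star` of a constant each edge is counted from both endpoints, hence the value 1/2. -/
theorem Omega_eq_star (n : ℕ) : Omega n = star n fun _ => 2⁻¹ := by
  refine A1_ext fun x y h => ?_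
  have hO : Omega n = ∑ i : Fin n, ∑ j, if i < j then w i j else 0 :=
    Finset.sum_congr rfl fun i _ => Finset.sum_filter _ _
  rw [entry_star _ _ _ h, hO]
  simp only [map_sum, apply_ite (entry x y), map_zero]
  have key : ∀ i j : Fin n, (if i < j then entry x y (w i j) else 0) =
      (if i = x then if j = y then if x < y then 1 else 0 else 0 else 0) +
      (if i = y then if j = x then if y < x then 1 else 0 else 0 else 0) := by
    intro i j
    rw [entry_w']
    by_cases h1 : i = x <;> by_cases h2 : j = y <;> by_cases h3 : j = x <;> by_cases h4 : i = y <;>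
      subst_vars <;> simp_all [eq_comm]
  simp only [key, Finset.sum_add_distrib, Finset.sum_ite_irrel, Finset.sum_const_zero,
    Finset.sum_ite_eq', Finset.mem_univ, if_true]
  rcases lt_or_gt_of_ne h with h | h <;> simp [h, h.not_gt] <;> norm_num

theorem star_const (n : ℕ) (c : ℚ) : star n (fun _ => c) = (2 * c) • Omega n := by
  rw [Omega_eq_star, ← map_smul]
  congr 1
  funext x
  simp [mul_comm]

theorem Omega₂_eq_star {n : ℕ} (i j : Fin n) :
    Omega₂ i j = star n (Pi.single i 1 - Pi.single j 1) := by
  by_cases h : i = j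
  · simp [h, Omega₂]
  rw [map_sub, star_single, star_single, ← Finset.sum_sub_distrib, Omega₂, Finset.sum_filter,
    ← sub_eq_zero, ← Finset.sum_sub_distrib]
  -- Only k = i and k = j distinguish the two sums; they contribute `w i j` with opposite signs.
  rw [Fintype.sum_eq_add i j h]
  · simp [w_comm i j]
  · rintro k ⟨h1, h2⟩
    simp [h1, h2]

theorem A1rep_Omega {n : ℕ} (π : Perm (Fin n)) : A1rep n π (Omega n) = Omega n := by
  rw [Omega_eq_star, A1rep_star]

theorem A1rep_Omega₂ {n : ℕ} (π : Perm (Fin n)) (i j : Fin n) :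
    A1rep n π (Omega₂ i j) = Omega₂ (π i) (π j) := by
  rw [Omega₂_eq_star, Omega₂_eq_star, A1rep_star]
  congr 1
  funext x
  simp [Pi.single_apply, Equiv.symm_apply_eq]

theorem A1rep_Omega₄ {n : ℕ} (π : Perm (Fin n)) (i j k l : Fin n) :
    A1rep n π (Omega₄ i j k l) = Omega₄ (π i) (π j) (π k) (π l) := by
  simp [Omega₄]

/-- `Omega₄` alternates signs around the 4-cycle i, l, j, k, so each vertex meets one edge of each
sign. -/
theorem rowSum_Omega₄ {n : ℕ} {i j k l : Fin n} (hik : i ≠ k) (hil : i ≠ l) (hjk : j ≠ k)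
    (hjl : j ≠ l) : rowSum n (Omega₄ i j k l) = 0 := by
  simp only [Omega₄, map_sub, map_add, rowSum_w _ _ hik, rowSum_w _ _ hil, rowSum_w _ _ hjk,
    rowSum_w _ _ hjl]
  abel

/-! ### The three submodules -/

/-- The invariant line spanned by `Ω^n`. -/
def U₀ (n : ℕ) : Subrepresentation (A1rep n) where
  toSubmodule := Submodule.span ℚ {Omega n}
  apply_mem_toSubmodule π v hv := by
    obtain ⟨c, rfl⟩ := Submodule.mem_span_singleton.1 hv
    rw [map_smul, A1rep_Omega]
    exact hv

/-- The vectors with vanishing coordinate sum. -/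
def sumZero (n : ℕ) : Submodule ℚ (Fin n → ℚ) := LinearMap.ker (∑ i, LinearMap.proj i)

theorem mem_sumZero {n : ℕ} {a : Fin n → ℚ} : a ∈ sumZero n ↔ ∑ i, a i = 0 := by
  simp [sumZero]

theorem single_sub_single_mem_sumZero {n : ℕ} (i j : Fin n) :
    (Pi.single i 1 - Pi.single j 1 : Fin n → ℚ) ∈ sumZero n := by
  rw [mem_sumZero]
  simp [Pi.single_apply]

/-- The image under `star` of the vectors with vanishing coordinate sum. -/
def U₁ (n : ℕ) : Subrepresentation (A1rep n) where
  toSubmodule := (sumZero n).map (star n)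
  apply_mem_toSubmodule π v hv := by
    obtain ⟨a, ha, rfl⟩ := hv
    refine ⟨_, ?_, (A1rep_star π a).symm⟩
    rw [SetLike.mem_coe, mem_sumZero] at ha ⊢
    rw [← ha]
    exact Equiv.sum_comp π⁻¹ a

/-- The elements of `A^1(n)` with vanishing row sums. -/
def U₂ (n : ℕ) : Subrepresentation (A1rep n) where
  toSubmodule := LinearMap.ker (rowSum n)
  apply_mem_toSubmodule π v hv := by
    rw [LinearMap.mem_ker] at hv ⊢
    funext x
    simp [rowSum_A1rep, hv]

/-- Applying `rowSum` removes u₂, and injectivity of `rowSum` after `star` reduces the claim to the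
independence of constants and sum-zero vectors in ℚ^n. -/
theorem add_add_eq_zero {n : ℕ} (hn : 3 ≤ n) {u₀ u₁ u₂ : A1 n} (h₀ : u₀ ∈ (U₀ n).toSubmodule)
    (h₁ : u₁ ∈ (U₁ n).toSubmodule) (h₂ : u₂ ∈ (U₂ n).toSubmodule) (h : u₀ + u₁ + u₂ = 0) :
    u₀ = 0 ∧ u₁ = 0 ∧ u₂ = 0 := by
  obtain ⟨c, rfl⟩ := Submodule.mem_span_singleton.1 h₀
  obtain ⟨a, ha, rfl⟩ := h₁
  rw [SetLike.mem_coe, mem_sumZero] at ha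
  have h₂' : rowSum n u₂ = 0 := h₂
  have hc : c • Omega n = star n fun _ => c / 2 := by
    rw [star_const]
    congr 1
    ring
  rw [hc] at h ⊢
  have key := congrArg (rowSum n) h
  rw [map_add, h₂', add_zero, map_zero, ← map_add] at key
  have key' := eq_zero_of_rowSum_star_eq_zero hn key
  have hsum := congrArg (fun f : Fin n → ℚ => ∑ i, f i) key'
  simp only [Pi.add_apply, Finset.sum_add_distrib, ha, Finset.sum_const, Finset.card_univ,
    Fintype.card_fin, nsmul_eq_mul, add_zero, Pi.zero_apply, mul_zero] at hsum
  have hn' : (n : ℚ) ≠ 0 := by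
    have : n ≠ 0 := by omega
    exact_mod_cast this
  have hc0 : c / 2 = 0 := (mul_eq_zero.1 hsum).resolve_left hn'
  have h0 : (fun _ : Fin n => c / 2) = 0 := funext fun _ => hc0
  rw [h0, zero_add] at key'
  rw [h0, key', map_zero] at h ⊢
  simpa using h

theorem exists_add_add_eq {n : ℕ} (hn : 3 ≤ n) (v : A1 n) :
    ∃ u₀ ∈ (U₀ n).toSubmodule, ∃ u₁ ∈ (U₁ n).toSubmodule, ∃ u₂ ∈ (U₂ n).toSubmodule,
      u₀ + u₁ + u₂ = v := by
  -- Subtracting `star n b` puts v in the kernel of `rowSum`; then b is split into its mean c and a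
  -- vector of sum zero.
  obtain ⟨b, hb⟩ := exists_rowSum_star_eq hn (rowSum n v)
  have hn' : (n : ℚ) ≠ 0 := by
    have : n ≠ 0 := by omega
    exact_mod_cast this
  set c : ℚ := (∑ i, b i) / n
  refine ⟨star n fun _ => c, ?_, star n (b - fun _ => c), ⟨_, ?_, rfl⟩, v - star n b, ?_, ?_⟩
  · rw [star_const]
    exact Submodule.smul_mem _ _ (Submodule.mem_span_singleton_self _)
  · rw [SetLike.mem_coe, mem_sumZero]
    simp only [Pi.sub_apply, Finset.sum_sub_distrib, Finset.sum_const, Finset.card_univ,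
      Fintype.card_fin, nsmul_eq_mul, c]
    field_simp
    ring
  · change rowSum n _ = 0
    rw [map_sub, hb, sub_self]
  · rw [map_sub]
    abel

/-! ### Bases -/

theorem Omega_ne_zero {n : ℕ} (hn : 2 ≤ n) : Omega n ≠ 0 := by
  intro h
  have := entry_star (n := n) (fun _ => 2⁻¹) ⟨0, by omega⟩ ⟨1, by omega⟩ (by simp)
  rw [← Omega_eq_star, h, map_zero] at this
  norm_num at this

theorem isBasisOf_B0 {n : ℕ} (hn : 2 ≤ n) : IsBasisOf (B0 n) (U₀ n).toSubmodule := by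
  refine ⟨?_, ?_⟩
  · exact LinearIndependent.of_subsingleton () (Omega_ne_zero hn)
  · rw [Set.range_unique]
    rfl

theorem linearIndependent_single_sub_single (n : ℕ) [NeZero n] :
    LinearIndependent ℚ
      fun j : {j : Fin n // j ≠ 0} => (Pi.single 0 1 - Pi.single j.1 1 : Fin n → ℚ) := by
  rw [Fintype.linearIndependent_iff]
  intro g hg j
  have := congrFun hg j.1
  simpa [Pi.single_apply, j.2, Subtype.coe_inj] using this

theorem span_single_sub_single (n : ℕ) [NeZero n] :
    Submodule.span ℚ (Set.range fun j : {j : Fin n // j ≠ 0} =>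
      (Pi.single 0 1 - Pi.single j.1 1 : Fin n → ℚ)) = sumZero n := by
  apply le_antisymm
  · rw [Submodule.span_le]
    rintro _ ⟨j, rfl⟩
    exact single_sub_single_mem_sumZero _ _
  · intro a ha
    rw [mem_sumZero] at ha
    -- The multiples of δ_0 add up to -∑ a = 0, and the term j = 0 vanishes.
    have : a = ∑ j : Fin n, (-a j) • (Pi.single 0 1 - Pi.single j 1 : Fin n → ℚ) := by
      funext x
      simp [mul_sub, Finset.sum_sub_distrib, ha, Pi.single_apply]
    rw [this]
    refine Submodule.sum_mem _ fun j _ => Submodule.smul_mem _ _ ?_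
    by_cases hj : j = 0
    · simp [hj]
    · exact Submodule.subset_span ⟨⟨j, hj⟩, rfl⟩

theorem B1_eq (n : ℕ) [NeZero n] :
    B1 n = star n ∘ fun j : {j : Fin n // j ≠ 0} => (Pi.single 0 1 - Pi.single j.1 1) :=
  funext fun j => Omega₂_eq_star 0 j.1

theorem isBasisOf_B1 {n : ℕ} [NeZero n] (hn : 3 ≤ n) :
    IsBasisOf (B1 n) (U₁ n).toSubmodule := by
  rw [IsBasisOf, B1_eq]
  refine ⟨?_, ?_⟩
  · exact (linearIndependent_single_sub_single n).map'
      (star n) (LinearMap.ker_eq_bot.2 (star_injective hn))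
  · rw [Set.range_comp, ← Submodule.map_span, span_single_sub_single]
    rfl

/-! ### The basis of the kernel of the row sums. -/

section

variable {n : ℕ} [NeZero n]

theorem fin_val_one (hn : 2 ≤ n) : ((1 : Fin n) : ℕ) = 1 :=
  (Nat.mod_eq_of_lt (by omega) : 1 % n = 1)

theorem fin_val_two (hn : 3 ≤ n) : ((2 : Fin n) : ℕ) = 2 :=
  (Nat.mod_eq_of_lt (by omega) : 2 % n = 2)

/-- Every edge of an `inl` element meets 0 or 1, while an `inr` element has exactly one edge
avoiding both, with sign -1. Such positions isolate the `inr` part; the positions (0, y) with y ≥ 3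
then isolate the `inl` part. -/
theorem entry_B2_of_two_le (hn : 3 ≤ n) {x y : Fin n} (hx : 2 ≤ (x : ℕ)) (hxy : x < y)
    (s : {j : Fin n // 3 ≤ (j : ℕ)} ⊕ {p : Fin n × Fin n // 2 ≤ (p.1 : ℕ) ∧ p.1 < p.2}) :
    entry x y (B2 n s) = if s = Sum.inr ⟨(x, y), hx, hxy⟩ then -1 else 0 := by
  have h0 : ((0 : Fin n) : ℕ) = 0 := rfl
  have h1 : ((1 : Fin n) : ℕ) = 1 := fin_val_one (by omega)
  have h2 : ((2 : Fin n) : ℕ) = 2 := fin_val_two hn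
  rcases s with ⟨j, hj⟩ | ⟨⟨i, j⟩, hi, hij⟩
  · simp only [B2, Sum.elim_inl, Omega₄, map_sub, map_add, entry_w', reduceCtorEq, if_false,
      Fin.ext_iff, h0, h1, Fin.lt_def] at hxy ⊢
    repeat rw [if_neg (by omega)]
    simp
  · have hij' : i < j := hij
    have hi' : 2 ≤ (i : ℕ) := hi
    simp only [B2, Sum.elim_inr, Omega₄, map_sub, map_add, entry_w', Sum.inr.injEq,
      Subtype.mk.injEq, Prod.mk.injEq, Fin.ext_iff, h0, h1, Fin.lt_def] at hxy ⊢
    rw [if_neg (by omega), if_neg (by omega), if_neg (by omega)]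
    by_cases h : (i : ℕ) = x ∧ (j : ℕ) = y
    · rw [if_pos (by omega), if_pos h]
      simp
    · rw [if_neg (by omega), if_neg h]
      simp

theorem entry_zero_B2_inl (hn : 3 ≤ n) {y : Fin n} (hy : 3 ≤ (y : ℕ))
    (j : {j : Fin n // 3 ≤ (j : ℕ)}) :
    entry 0 y (B2 n (Sum.inl j)) = if j = ⟨y, hy⟩ then 1 else 0 := by
  have h0 : ((0 : Fin n) : ℕ) = 0 := rfl
  have h1 : ((1 : Fin n) : ℕ) = 1 := fin_val_one (by omega)
  have h2 : ((2 : Fin n) : ℕ) = 2 := fin_val_two hn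
  obtain ⟨j, hj⟩ := j
  simp only [B2, Sum.elim_inl, Omega₄, map_sub, map_add, entry_w', Subtype.mk.injEq,
    Fin.ext_iff, h0, h1, h2, ne_eq, true_and]
  by_cases h : (j : ℕ) = y
  · rw [if_pos (by omega), if_neg (by omega), if_neg (by omega), if_neg (by omega), if_pos h]
    simp
  · rw [if_neg (by omega), if_neg (by omega), if_neg (by omega), if_neg (by omega), if_neg h]
    simp

theorem B2_mem (hn : 3 ≤ n)
    (s : {j : Fin n // 3 ≤ (j : ℕ)} ⊕ {p : Fin n × Fin n // 2 ≤ (p.1 : ℕ) ∧ p.1 < p.2}) :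
    B2 n s ∈ (U₂ n).toSubmodule := by
  have h0 : ((0 : Fin n) : ℕ) = 0 := rfl
  have h1 : ((1 : Fin n) : ℕ) = 1 := fin_val_one (by omega)
  have h2 : ((2 : Fin n) : ℕ) = 2 := fin_val_two hn
  rcases s with ⟨j, hj⟩ | ⟨⟨i, j⟩, hi, hij⟩
  · apply rowSum_Omega₄ <;> rw [ne_eq, Fin.ext_iff] <;> (try dsimp only) <;> omega
  · have hij' : i < j := hij
    have hi' : 2 ≤ (i : ℕ) := hi
    apply rowSum_Omega₄ <;> rw [ne_eq, Fin.ext_iff] <;> (try dsimp only) <;> omega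

/-- Row y ≥ 3 has only its entries at 0 and 1 left, so the vanishing of the first forces that of the
second. What remains is the triangle 0, 1, 2. -/
theorem eq_zero_of_entry_eq_zero (hn : 3 ≤ n) {v : A1 n} (hv : v ∈ (U₂ n).toSubmodule)
    (h2 : ∀ x y : Fin n, 2 ≤ (x : ℕ) → x < y → entry x y v = 0)
    (h0 : ∀ y : Fin n, 3 ≤ (y : ℕ) → entry 0 y v = 0) : v = 0 := by
  have v0 : ((0 : Fin n) : ℕ) = 0 := rfl
  have v1 : ((1 : Fin n) : ℕ) = 1 := fin_val_one (by omega)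
  have v2 : ((2 : Fin n) : ℕ) = 2 := fin_val_two hn
  have h01 : (0 : Fin n) ≠ 1 := by rw [ne_eq, Fin.ext_iff, v0, v1]; decide
  have h02 : (0 : Fin n) ≠ 2 := by rw [ne_eq, Fin.ext_iff, v0, v2]; decide
  have h12 : (1 : Fin n) ≠ 2 := by rw [ne_eq, Fin.ext_iff, v1, v2]; decide
  have big : ∀ x y : Fin n, 2 ≤ (x : ℕ) → 2 ≤ (y : ℕ) → entry x y v = 0 := by
    intro x y hx hy
    rcases lt_trichotomy x y with h | h | h
    · exact h2 x y hx h
    · rw [h, entry_self]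
    · rw [entry_comm]
      exact h2 y x hy h
  have two_le : ∀ x : Fin n, x ≠ 0 ∧ x ≠ 1 → 2 ≤ (x : ℕ) := by
    rintro x ⟨hx0, hx1⟩
    simp only [ne_eq, Fin.ext_iff, v0, v1] at hx0 hx1
    omega
  have row : ∀ i, ∑ y, entry i y v = 0 := fun i => by
    rw [← rowSum_apply, show rowSum n v = 0 from hv, Pi.zero_apply]
  have row_big : ∀ x : Fin n, 2 ≤ (x : ℕ) → entry x 0 v + entry x 1 v = 0 := by
    intro x hx
    rw [← row x, Fintype.sum_eq_add 0 1 h01]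
    exact fun y hy => big x y hx (two_le y hy)
  have h1 : ∀ y : Fin n, 3 ≤ (y : ℕ) → entry 1 y v = 0 := by
    intro y hy
    have := row_big y (by omega)
    rwa [entry_comm y 0, h0 y hy, zero_add, entry_comm] at this
  have three_le : ∀ x : Fin n, x ≠ 0 → x ≠ 1 → x ≠ 2 → 3 ≤ (x : ℕ) := by
    intro x hx0 hx1 hx2
    simp only [ne_eq, Fin.ext_iff, v0, v1, v2] at hx0 hx1 hx2
    omega
  -- Rows 0, 1 and 2 say that the three entries of the triangle have pairwise sums zero, so all
  -- vanish.
  have r0 : entry 0 1 v + entry 0 2 v = 0 := by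
    rw [← row 0, Fintype.sum_eq_add 1 2 h12]
    rintro y ⟨hy1, hy2⟩
    by_cases hy0 : y = 0
    · rw [hy0, entry_self]
    · exact h0 y (three_le y hy0 hy1 hy2)
  have r1 : entry 1 0 v + entry 1 2 v = 0 := by
    rw [← row 1, Fintype.sum_eq_add 0 2 h02]
    rintro y ⟨hy0, hy2⟩
    by_cases hy1 : y = 1
    · rw [hy1, entry_self]
    · exact h1 y (three_le y hy0 hy1 hy2)
  have r2 := row_big 2 v2.ge
  rw [entry_comm 1 0] at r1
  rw [entry_comm 2 0, entry_comm 2 1] at r2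
  have key : ∀ x y : Fin n, x < y → entry x y v = 0 := by
    intro x y hxy
    have hy0 : y ≠ 0 := fun h => by simp [h] at hxy
    by_cases hx : 2 ≤ (x : ℕ)
    · exact h2 x y hx hxy
    by_cases hx0 : x = 0
    · subst hx0
      by_cases hy1 : y = 1
      · rw [hy1]; linarith
      by_cases hy2 : y = 2
      · rw [hy2]; linarith
      exact h0 y (three_le y hy0 hy1 hy2)
    · have hx1 : x = 1 := by
        by_contra hx1
        exact hx (two_le x ⟨hx0, hx1⟩)
      subst hx1
      by_cases hy2 : y = 2
      · rw [hy2]; linarith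
      exact h1 y (three_le y hy0 hxy.ne' hy2)
  refine A1_ext fun x y hxy => ?_
  rw [map_zero]
  rcases lt_or_gt_of_ne hxy with h | h
  · exact key x y h
  · rw [entry_comm]
    exact key y x h

theorem isBasisOf_B2 (hn : 3 ≤ n) : IsBasisOf (B2 n) (U₂ n).toSubmodule := by
  refine ⟨?_, le_antisymm ?_ fun v hv => ?_⟩
  · rw [Fintype.linearIndependent_iff]
    intro g hg
    have hr : ∀ p, g (Sum.inr p) = 0 := by
      rintro ⟨⟨x, y⟩, hx, hxy⟩
      have := congrArg (entry x y) hg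
      simpa [entry_B2_of_two_le hn hx hxy] using this
    rintro (⟨j, hj⟩ | p)
    · have := congrArg (entry 0 j) hg
      simpa [hr, entry_zero_B2_inl hn hj] using this
    · exact hr p
  · rw [Submodule.span_le]
    rintro _ ⟨s, rfl⟩
    exact B2_mem hn s
  · have mem : ∀ s, B2 n s ∈ Submodule.span ℚ (Set.range (B2 n)) :=
      fun s => Submodule.subset_span ⟨s, rfl⟩
    -- Because of the sign -1 in `entry_B2_of_two_le`, adding a clears the entries away from 0 and
    -- 1; subtracting b then clears the entries (0, y) with y ≥ 3 without disturbing the former.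
    set a : A1 n := ∑ p : {p : Fin n × Fin n // 2 ≤ (p.1 : ℕ) ∧ p.1 < p.2},
      entry p.1.1 p.1.2 v • B2 n (Sum.inr p) with ha
    set b : A1 n := ∑ j : {j : Fin n // 3 ≤ (j : ℕ)},
      entry 0 j.1 (v + a) • B2 n (Sum.inl j) with hb
    have ha_mem : a ∈ Submodule.span ℚ (Set.range (B2 n)) :=
      Submodule.sum_mem _ fun p _ => Submodule.smul_mem _ _ (mem _)
    have hb_mem : b ∈ Submodule.span ℚ (Set.range (B2 n)) :=
      Submodule.sum_mem _ fun p _ => Submodule.smul_mem _ _ (mem _)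
    have ha_mem' : a ∈ (U₂ n).toSubmodule :=
      Submodule.sum_mem _ fun p _ => Submodule.smul_mem _ _ (B2_mem hn _)
    have hb_mem' : b ∈ (U₂ n).toSubmodule :=
      Submodule.sum_mem _ fun p _ => Submodule.smul_mem _ _ (B2_mem hn _)
    have key : v + a - b = 0 := by
      refine eq_zero_of_entry_eq_zero hn (sub_mem (add_mem hv ha_mem') hb_mem') ?_ ?_
      · intro x y hx hxy
        have h1 : entry x y a = -entry x y v := by
          rw [ha, map_sum]
          simp only [map_smul, entry_B2_of_two_le hn hx hxy, Sum.inr.injEq, smul_eq_mul,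
            mul_ite, mul_zero, Finset.sum_ite_eq', Finset.mem_univ, if_true]
          ring
        have h2 : entry x y b = 0 := by
          rw [hb, map_sum]
          simp [entry_B2_of_two_le hn hx hxy]
        rw [map_sub, map_add, h1, h2]
        ring
      · intro y hy
        rw [map_sub, hb, map_sum]
        simp [entry_zero_B2_inl hn hy]
    have : v = b - a := by
      rw [← sub_eq_zero, ← key]
      abel
    rw [this]
    exact sub_mem hb_mem ha_mem

end

/-! ### Irreducibility -/

/-- Pushing a subrepresentation of U forward to M lets irreducibility be tested with
subrepresentations of the ambient module, where the explicit group elements act. -/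
theorem isIrreducible_of_forall_le {G M : Type*} [Group G] [AddCommGroup M] [Module ℚ M]
    {ρ : Representation ℚ G M} (U : Subrepresentation ρ) (hU : U.toSubmodule ≠ ⊥)
    (h : ∀ W : Subrepresentation ρ, ∀ v ∈ W.toSubmodule, v ∈ U.toSubmodule → v ≠ 0 →
      U.toSubmodule ≤ W.toSubmodule) : IsSimpleOrder (Subrepresentation U.toRepresentation) := by
  have hnt : Nontrivial (Subrepresentation U.toRepresentation) := by
    refine ⟨⊥, ⊤, fun hbt => hU ?_⟩
    rw [Submodule.eq_bot_iff]
    intro v hv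
    have h1 : (⊥ : Submodule ℚ U.toSubmodule) = ⊤ := congrArg Subrepresentation.toSubmodule hbt
    have h2 : (⟨v, hv⟩ : U.toSubmodule) ∈ (⊥ : Submodule ℚ U.toSubmodule) := by
      rw [h1]
      exact Submodule.mem_top
    exact congrArg Subtype.val ((Submodule.mem_bot ℚ).1 h2)
  refine { hnt with eq_bot_or_eq_top := fun W => ?_ }
  by_cases hW : W.toSubmodule = ⊥
  · exact Or.inl (Subrepresentation.toSubmodule_injective hW)
  · right
    obtain ⟨v, hv, hv0⟩ := Submodule.exists_mem_ne_zero_of_ne_bot hW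
    let W' : Subrepresentation ρ :=
      { toSubmodule := W.toSubmodule.map U.toSubmodule.subtype
        apply_mem_toSubmodule := by
          rintro g _ ⟨u, hu, rfl⟩
          exact ⟨_, W.apply_mem_toSubmodule g hu, rfl⟩ }
    have hle := h W' v.1 ⟨v, hv, rfl⟩ v.2 (fun h0 => hv0 (Subtype.ext h0))
    apply Subrepresentation.toSubmodule_injective
    refine eq_top_iff.2 fun u _ => ?_
    obtain ⟨u', hu', he⟩ := hle u.2
    rwa [← Subtype.ext he]

theorem isIrreducible_U₀ {n : ℕ} (hn : 2 ≤ n) : IsSimpleOrder (Subrepresentation (U₀ n).toRepresentation) := by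
  refine isIrreducible_of_forall_le _ ?_ fun W v hvW hvU hv0 => ?_
  · change Submodule.span ℚ {Omega n} ≠ ⊥
    rw [ne_eq, Submodule.span_singleton_eq_bot]
    exact Omega_ne_zero hn
  · obtain ⟨c, rfl⟩ := Submodule.mem_span_singleton.1 hvU
    have hc : c ≠ 0 := fun hc => hv0 (by rw [hc, zero_smul])
    refine (Submodule.span_singleton_le_iff_mem _ _).2 ?_
    exact (Submodule.smul_mem_iff _ hc).1 hvW

/-- The symmetric group is 2-transitive, so the orbit of one `Omega₂ i j` contains all of `B1`. -/
theorem U₁_le_of_Omega₂_mem {n : ℕ} [NeZero n] (hn : 3 ≤ n) (W : Subrepresentation (A1rep n))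
    {i j : Fin n} (hij : i ≠ j) (h : Omega₂ i j ∈ W.toSubmodule) :
    (U₁ n).toSubmodule ≤ W.toSubmodule := by
  rw [← (isBasisOf_B1 hn).2, Submodule.span_le]
  rintro _ ⟨⟨l, hl⟩, rfl⟩
  obtain ⟨σ, hσ⟩ := Perm.exists_extending_pair ![i, j] ![0, l]
    (by intro a b; fin_cases a <;> fin_cases b <;> simp [hij, hij.symm])
    (by intro a b; fin_cases a <;> fin_cases b <;> simp [hl, Ne.symm hl])
  have := W.apply_mem_toSubmodule σ h
  rwa [A1rep_Omega₂, show σ i = 0 from hσ 0, show σ j = l from hσ 1] at this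

theorem isIrreducible_U₁ {n : ℕ} (hn : 3 ≤ n) : IsSimpleOrder (Subrepresentation (U₁ n).toRepresentation) := by
  have : NeZero n := ⟨by omega⟩
  refine isIrreducible_of_forall_le _ ?_ fun W v hvW hvU hv0 => ?_
  · intro hbot
    have hmem : star n (Pi.single 0 1 - Pi.single 1 1) ∈ (U₁ n).toSubmodule :=
      ⟨_, single_sub_single_mem_sumZero _ _, rfl⟩
    rw [hbot, Submodule.mem_bot, ← map_zero (star n)] at hmem
    have := congrFun (star_injective hn hmem) 0
    have h01 : (0 : Fin n) ≠ 1 := by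
      rw [ne_eq, Fin.ext_iff, fin_val_one (by omega)]
      exact zero_ne_one
    simp [h01] at this
  · obtain ⟨a, ha, rfl⟩ := hvU
    rw [SetLike.mem_coe, mem_sumZero] at ha
    -- A constant vector of sum zero is zero, so a is not constant.
    obtain ⟨i, j, hij⟩ : ∃ i j, a i ≠ a j := by
      by_contra! hconst
      apply hv0
      have h0 : a = fun _ => a 0 := funext fun i => hconst i 0
      rw [h0] at ha
      have hn' : n ≠ 0 := by omega
      have : a 0 = 0 := by simpa [hn'] using ha
      rw [h0, this]
      exact map_zero _
    have hne : i ≠ j := fun h => hij (h ▸ rfl)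
    have hmem := W.toSubmodule.sub_mem hvW (W.apply_mem_toSubmodule (swap i j) hvW)
    -- The operator 1 - (i j) sends a to (a i - a j)(δ_i - δ_j).
    have key : star n a - A1rep n (swap i j) (star n a) = (a i - a j) • Omega₂ i j := by
      rw [A1rep_star, Omega₂_eq_star, ← map_sub, ← map_smul]
      congr 1
      funext x
      by_cases hxi : x = i
      · subst hxi
        simp [hne]
      by_cases hxj : x = j
      · subst hxj
        simp [hne.symm]
      simp [hxi, hxj, swap_apply_of_ne_of_ne]
    rw [key] at hmem
    exact U₁_le_of_Omega₂_mem hn W hne ((Submodule.smul_mem_iff _ (sub_ne_zero.2 hij)).1 hmem)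

theorem injective_vec_four {α : Type*} {a b c d : α} (hab : a ≠ b) (hac : a ≠ c) (had : a ≠ d)
    (hbc : b ≠ c) (hbd : b ≠ d) (hcd : c ≠ d) : Function.Injective ![a, b, c, d] := by
  intro x y h
  fin_cases x <;> fin_cases y <;> first
    | rfl
    | exact absurd h (by assumption)
    | exact absurd h.symm (by assumption)

/-- Every element of `B(n-2,2)` is of the form `Ω_{ijkl}` with distinct indices. -/
theorem exists_B2_eq_Omega₄ {n : ℕ} [NeZero n] (hn : 3 ≤ n)
    (s : {j : Fin n // 3 ≤ (j : ℕ)} ⊕ {p : Fin n × Fin n // 2 ≤ (p.1 : ℕ) ∧ p.1 < p.2}) :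
    ∃ f : Fin 4 → Fin n, Function.Injective f ∧ B2 n s = Omega₄ (f 0) (f 1) (f 2) (f 3) := by
  have h0 : ((0 : Fin n) : ℕ) = 0 := rfl
  have h1 : ((1 : Fin n) : ℕ) = 1 := fin_val_one (by omega)
  have h2 : ((2 : Fin n) : ℕ) = 2 := fin_val_two hn
  rcases s with ⟨j, hj⟩ | ⟨⟨i, j⟩, hi, hij⟩
  · refine ⟨![0, 1, 2, j], ?_, rfl⟩
    apply injective_vec_four <;> rw [ne_eq, Fin.ext_iff] <;> omega
  · have hij' : (i : ℕ) < j := hij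
    have hi' : 2 ≤ (i : ℕ) := hi
    refine ⟨![0, i, 1, j], ?_, rfl⟩
    apply injective_vec_four <;> rw [ne_eq, Fin.ext_iff] <;> omega

/-- All elements of `B2` are `Omega₄` at four distinct indices, and permutations carry any such
quadruple to any other. -/
theorem U₂_le_of_Omega₄_mem {n : ℕ} [NeZero n] (hn : 3 ≤ n) (W : Subrepresentation (A1rep n))
    {f : Fin 4 → Fin n} (hf : Function.Injective f)
    (h : Omega₄ (f 0) (f 1) (f 2) (f 3) ∈ W.toSubmodule) :
    (U₂ n).toSubmodule ≤ W.toSubmodule := by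
  rw [← (isBasisOf_B2 hn).2, Submodule.span_le]
  rintro _ ⟨s, rfl⟩
  obtain ⟨g, hg, hs⟩ := exists_B2_eq_Omega₄ hn s
  obtain ⟨σ, hσ⟩ := Perm.exists_extending_pair f g hf hg
  have := W.apply_mem_toSubmodule σ h
  rwa [A1rep_Omega₄, hσ, hσ, hσ, hσ, ← hs] at this

/-- The invariant bilinear form on `A^1(n)` for which the `w_{ij}` are orthogonal. -/
def pairing {n : ℕ} (v : A1 n) : A1 n →ₗ[ℚ] ℚ := ∑ x, ∑ y, entry x y v • entry x y

theorem pairing_w {n : ℕ} (v : A1 n) (i j : Fin n) (h : i ≠ j) :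
    pairing v (w i j) = 2 * entry i j v := by
  have key : ∀ x y, entry x y v * entry x y (w i j) =
      (if x = i then if y = j then entry x y v else 0 else 0) +
      (if x = j then if y = i then entry x y v else 0 else 0) := by
    intro x y
    rw [entry_w x y i j h]
    by_cases h1 : x = i <;> by_cases h2 : y = j <;> by_cases h3 : x = j <;> by_cases h4 : y = i <;>
      subst_vars <;> simp_all
  simp only [pairing, LinearMap.coe_sum, Finset.sum_apply, LinearMap.smul_apply, smul_eq_mul, key,
    Finset.sum_add_distrib, Finset.sum_ite_irrel, Finset.sum_const_zero, Finset.sum_ite_eq',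
    Finset.mem_univ, if_true, entry_comm j i]
  ring

/-- The form is a sum of squares of rational coordinates, hence definite. -/
theorem eq_zero_of_pairing_self {n : ℕ} {v : A1 n} (h : pairing v v = 0) : v = 0 := by
  simp only [pairing, LinearMap.coe_sum, Finset.sum_apply, LinearMap.smul_apply,
    smul_eq_mul] at h
  refine A1_ext fun x y _ => ?_
  rw [Finset.sum_eq_zero_iff_of_nonneg
    fun x _ => Finset.sum_nonneg fun y _ => mul_self_nonneg _] at h
  have h' := h x (Finset.mem_univ x)
  rw [Finset.sum_eq_zero_iff_of_nonneg fun y _ => mul_self_nonneg _] at h'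
  rw [map_zero]
  exact mul_self_eq_zero.1 (h' y (Finset.mem_univ y))

/-- The alternating sum over the group generated by two disjoint transpositions projects
`A^1(n)` to the line spanned by `Ω_{ijkl}`. -/
theorem column_antisymmetrize {n : ℕ} {i j k l : Fin n} (hij : i ≠ j) (hik : i ≠ k) (hil : i ≠ l)
    (hjk : j ≠ k) (hjl : j ≠ l) (hkl : k ≠ l) (v : A1 n) :
    v - A1rep n (swap i j) v - (A1rep n (swap k l) v - A1rep n (swap i j) (A1rep n (swap k l) v)) =
      (entry i l v - entry i k v + entry j k v - entry j l v) • Omega₄ i j k l := by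
  refine A1_ext fun x y hxy => ?_
  -- An index is one of i, j, k, l or is fixed by both transpositions, so comparing entries is a
  -- finite check.
  have aux : ∀ x, x = i ∨ x = j ∨ x = k ∨ x = l ∨ (x ≠ i ∧ x ≠ j ∧ x ≠ k ∧ x ≠ l) := by
    intro x
    tauto
  have eij : entry j i v = entry i j v := by rw [entry_comm]
  have eik : entry k i v = entry i k v := by rw [entry_comm]
  have eil : entry l i v = entry i l v := by rw [entry_comm]
  have ejk : entry k j v = entry j k v := by rw [entry_comm]
  have ejl : entry l j v = entry j l v := by rw [entry_comm]
  have ekl : entry l k v = entry k l v := by rw [entry_comm]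
  have ax := aux x
  have ay := aux y
  clear aux
  simp only [map_sub, map_smul, map_add, entry_A1rep, swap_inv, Omega₄, smul_eq_mul]
  rcases ax with rfl | rfl | rfl | rfl | ⟨x1, x2, x3, x4⟩ <;>
  rcases ay with rfl | rfl | rfl | rfl | ⟨y1, y2, y3, y4⟩ <;>
  first
  | exact absurd rfl hxy
  | (simp [swap_apply_of_ne_of_ne, entry_w', *, hij.symm, hik.symm, hil.symm, hjk.symm, hjl.symm,
      hkl.symm]; try ring)

theorem isIrreducible_U₂ {n : ℕ} (hn : 4 ≤ n) : IsSimpleOrder (Subrepresentation (U₂ n).toRepresentation) := by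
  have : NeZero n := ⟨by omega⟩
  have hn3 : 3 ≤ n := by omega
  refine isIrreducible_of_forall_le _ ?_ fun W v hvW hvU hv0 => ?_
  · intro hbot
    have hmem := B2_mem hn3 (Sum.inl ⟨⟨3, hn⟩, le_rfl⟩)
    rw [hbot, Submodule.mem_bot] at hmem
    exact (isBasisOf_B2 hn3).1.ne_zero _ hmem
  -- If v were orthogonal to the spanning family `B2` of `U₂`, it would be orthogonal to itself.
  · obtain ⟨s, hs⟩ : ∃ s, pairing v (B2 n s) ≠ 0 := by
      by_contra! hall
      apply hv0
      apply eq_zero_of_pairing_self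
      have hle : (U₂ n).toSubmodule ≤ LinearMap.ker (pairing v) := by
        rw [← (isBasisOf_B2 hn3).2, Submodule.span_le]
        rintro _ ⟨s, rfl⟩
        exact hall s
      exact hle hvU
    obtain ⟨f, hf, hBf⟩ := exists_B2_eq_Omega₄ hn3 s
    have h01 : f 0 ≠ f 1 := hf.ne (by decide)
    have h02 : f 0 ≠ f 2 := hf.ne (by decide)
    have h03 : f 0 ≠ f 3 := hf.ne (by decide)
    have h12 : f 1 ≠ f 2 := hf.ne (by decide)
    have h13 : f 1 ≠ f 3 := hf.ne (by decide)
    have h23 : f 2 ≠ f 3 := hf.ne (by decide)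
    rw [hBf, Omega₄, map_sub, map_add, map_sub, pairing_w _ _ _ h03, pairing_w _ _ _ h02,
      pairing_w _ _ _ h12, pairing_w _ _ _ h13] at hs
    -- The pairing of v with `Omega₄` is twice the coefficient produced by `column_antisymmetrize`.
    have hc : entry (f 0) (f 3) v - entry (f 0) (f 2) v + entry (f 1) (f 2) v -
        entry (f 1) (f 3) v ≠ 0 := by
      intro h
      apply hs
      linarith
    have key := column_antisymmetrize h01 h02 h03 h12 h13 h23 v
    have m1 := W.apply_mem_toSubmodule (swap (f 0) (f 1)) hvW
    have m2 := W.apply_mem_toSubmodule (swap (f 2) (f 3)) hvW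
    have m3 := W.apply_mem_toSubmodule (swap (f 0) (f 1)) m2
    have m := W.toSubmodule.sub_mem (W.toSubmodule.sub_mem hvW m1) (W.toSubmodule.sub_mem m2 m3)
    rw [key] at m
    exact U₂_le_of_Omega₄_mem hn3 W hf ((Submodule.smul_mem_iff _ hc).1 m)

/-! ### Tableaux of two-row shape -/

theorem mem_twoRow {n k : ℕ} {h : 2 * k ≤ n} {c : ℕ × ℕ} :
    c ∈ (twoRow n k h).cells ↔ c.1 = 0 ∧ c.2 < n - k ∨ c.1 = 1 ∧ c.2 < k := by
  rw [YoungDiagram.mem_cells, twoRow, YoungDiagram.mem_ofRowLens]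
  rcases c with ⟨_ | _ | i, j⟩ <;> simp

theorem card_twoRow {n k : ℕ} (h : 2 * k ≤ n) : (twoRow n k h).cells.card = n := by
  have : (twoRow n k h).cells =
      ({0} : Finset ℕ) ×ˢ Finset.range (n - k) ∪ ({1} : Finset ℕ) ×ˢ Finset.range k := by
    ext ⟨i, j⟩
    rw [mem_twoRow]
    simp [eq_comm, and_comm]
  rw [this, Finset.card_union_of_disjoint, Finset.card_product, Finset.card_product]
  · simp
    omega
  · rw [Finset.disjoint_left]
    rintro ⟨i, j⟩
    simp
    omega

theorem nonempty_tableau {n k : ℕ} (h : 2 * k ≤ n) : Nonempty (Tableau n (twoRow n k h)) := by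
  refine ⟨Fintype.equivOfCardEq ?_⟩
  rw [Fintype.card_fin, Fintype.card_coe, card_twoRow]

section

variable {n k : ℕ} {h : 2 * k ≤ n}

/-- The entry in row `0` and column `j`. -/
def topEntry (t : Tableau n (twoRow n k h)) (j : ℕ) (hj : j < n - k) : Fin n :=
  t ⟨(0, j), mem_twoRow.2 (Or.inl ⟨rfl, hj⟩)⟩

/-- The entry in row `1` and column `j`. -/
def bottomEntry (t : Tableau n (twoRow n k h)) (j : ℕ) (hj : j < k) : Fin n :=
  t ⟨(1, j), mem_twoRow.2 (Or.inr ⟨rfl, hj⟩)⟩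

@[simp]
theorem symm_topEntry (t : Tableau n (twoRow n k h)) (j : ℕ) (hj : j < n - k) :
    (t.symm (topEntry t j hj)).1 = (0, j) := by
  simp [topEntry]

@[simp]
theorem symm_bottomEntry (t : Tableau n (twoRow n k h)) (j : ℕ) (hj : j < k) :
    (t.symm (bottomEntry t j hj)).1 = (1, j) := by
  simp [bottomEntry]

theorem eq_topEntry_or_eq_bottomEntry (t : Tableau n (twoRow n k h)) (x : Fin n) :
    (∃ hj, x = topEntry t (t.symm x).1.2 hj) ∨ (∃ hj, x = bottomEntry t (t.symm x).1.2 hj) := by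
  rcases mem_twoRow.1 (t.symm x).2 with ⟨h1, h2⟩ | ⟨h1, h2⟩
  · refine Or.inl ⟨h2, ?_⟩
    rw [topEntry, ← Equiv.symm_apply_eq]
    exact Subtype.ext (Prod.ext h1 rfl)
  · refine Or.inr ⟨h2, ?_⟩
    rw [bottomEntry, ← Equiv.symm_apply_eq]
    exact Subtype.ext (Prod.ext h1 rfl)

theorem eq_or_eq_of_column_eq (t : Tableau n (twoRow n k h)) (x : Fin n) {j : ℕ} (hj : j < k)
    (hx : (t.symm x).1.2 = j) : x = topEntry t j (by omega) ∨ x = bottomEntry t j hj := by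
  subst hx
  rcases eq_topEntry_or_eq_bottomEntry t x with ⟨_, h1⟩ | ⟨_, h1⟩
  exacts [Or.inl h1, Or.inr h1]

/-- A column of index at least k has a single cell, so column-preserving permutations fix its entry.
-/
theorem eq_of_column_eq (t : Tableau n (twoRow n k h)) (x y : Fin n)
    (hk : k ≤ (t.symm x).1.2) (hxy : (t.symm y).1.2 = (t.symm x).1.2) : y = x := by
  rcases eq_topEntry_or_eq_bottomEntry t x with ⟨h1, h1'⟩ | ⟨h1, h1'⟩
  · rcases eq_topEntry_or_eq_bottomEntry t y with ⟨h2, h2'⟩ | ⟨h2, h2'⟩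
    · rw [h1', h2']
      congr 1
    · omega
  · omega

theorem column_swap (t : Tableau n (twoRow n k h)) {a b : Fin n}
    (hab : (t.symm a).1.2 = (t.symm b).1.2) (x : Fin n) :
    (t.symm (swap a b x)).1.2 = (t.symm x).1.2 := by
  by_cases ha : x = a
  · rw [ha, swap_apply_left, hab]
  by_cases hb : x = b
  · rw [hb, swap_apply_right, hab]
  rw [swap_apply_of_ne_of_ne ha hb]

theorem tabloid_eq_ite (t : Tableau n (twoRow n k h)) (x : Fin n) :
    tabloid t x = if ∃ j hj, x = bottomEntry t j hj then 1 else 0 := by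
  split_ifs with hx
  · obtain ⟨j, hj, rfl⟩ := hx
    simp [tabloid]
  · rcases eq_topEntry_or_eq_bottomEntry t x with ⟨h1, h1'⟩ | ⟨h1, h1'⟩
    · rw [h1']
      simp [tabloid]
    · exact absurd ⟨_, h1, h1'⟩ hx

theorem tabloid_trans {μ : YoungDiagram} (t : Tableau n μ) (π : Perm (Fin n)) (x : Fin n) :
    tabloid (t.trans π) x = tabloid t (π.symm x) := rfl

theorem topEntry_ne_bottomEntry (t : Tableau n (twoRow n k h)) {i j : ℕ} (hi : i < n - k)
    (hj : j < k) : topEntry t i hi ≠ bottomEntry t j hj := by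
  intro he
  have := congrArg (fun x => (t.symm x).1) he
  simp at this

theorem topEntry_ne_topEntry (t : Tableau n (twoRow n k h)) {i j : ℕ} (hi : i < n - k)
    (hj : j < n - k) (hij : i ≠ j) : topEntry t i hi ≠ topEntry t j hj := by
  intro he
  have := congrArg (fun x => (t.symm x).1) he
  simp [hij] at this

theorem bottomEntry_ne_bottomEntry (t : Tableau n (twoRow n k h)) {i j : ℕ} (hi : i < k)
    (hj : j < k) (hij : i ≠ j) : bottomEntry t i hi ≠ bottomEntry t j hj := by
  intro he
  have := congrArg (fun x => (t.symm x).1) he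
  simp [hij] at this

theorem mem_columnStabilizer {μ : YoungDiagram} (t : Tableau n μ) (π : Perm (Fin n)) :
    π ∈ columnStabilizer t ↔ ∀ x, (t.symm (π x)).1.2 = (t.symm x).1.2 := by
  simp [columnStabilizer]

end

/-! ### Polytabloids of two-row shape -/

/-- The tabloid with all entries in row `0`. -/
def tabloid₀ (n : ℕ) : (Fin n → ℕ) →₀ ℚ := Finsupp.single (fun _ => 0) 1

/-- The tabloid whose second row is `{i}`. -/
def tabloid₁ {n : ℕ} (i : Fin n) : (Fin n → ℕ) →₀ ℚ :=
  Finsupp.single (fun x => if x = i then 1 else 0) 1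

/-- The tabloid whose second row is `{i, j}`. -/
def tabloid₂ {n : ℕ} (i j : Fin n) : (Fin n → ℕ) →₀ ℚ :=
  Finsupp.single (fun x => if x = i ∨ x = j then 1 else 0) 1

theorem rowRep_tabloid₀ {n : ℕ} (π : Perm (Fin n)) : rowRep n π (tabloid₀ n) = tabloid₀ n := by
  simp [rowRep, tabloid₀]

theorem rowRep_tabloid₁ {n : ℕ} (π : Perm (Fin n)) (i : Fin n) :
    rowRep n π (tabloid₁ i) = tabloid₁ (π i) := by
  simp [rowRep, tabloid₁, Equiv.symm_apply_eq]

theorem rowRep_tabloid₂ {n : ℕ} (π : Perm (Fin n)) (i j : Fin n) :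
    rowRep n π (tabloid₂ i j) = tabloid₂ (π i) (π j) := by
  simp [rowRep, tabloid₂, Equiv.symm_apply_eq]

theorem tabloid₂_comm {n : ℕ} (i j : Fin n) : tabloid₂ i j = tabloid₂ j i := by
  simp only [tabloid₂, or_comm]

theorem polytabloid_zero {n : ℕ} {h : 2 * 0 ≤ n} (t : Tableau n (twoRow n 0 h)) :
    polytabloid t = tabloid₀ n := by
  have hC : columnStabilizer t = {1} := by
    ext π
    rw [mem_columnStabilizer, Finset.mem_singleton]
    refine ⟨fun hπ => ?_, ?_⟩
    · ext1 x
      exact eq_of_column_eq t x (π x) (Nat.zero_le _) (hπ x)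
    · rintro rfl x
      rfl
  rw [polytabloid, hC, Finset.sum_singleton, tabloid₀]
  congr 1
  · funext x
    rw [tabloid_trans, tabloid_eq_ite, if_neg]
    rintro ⟨j, hj, _⟩
    omega
  · simp

/-- Only column 0 has two cells, so the column group is generated by one transposition. -/
theorem polytabloid_one {n : ℕ} {h : 2 * 1 ≤ n} (t : Tableau n (twoRow n 1 h)) :
    polytabloid t =
      tabloid₁ (bottomEntry t 0 one_pos) - tabloid₁ (topEntry t 0 (by omega)) := by
  set c := bottomEntry t 0 one_pos with hc
  set a := topEntry t 0 (by omega) with ha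
  have hac : a ≠ c := topEntry_ne_bottomEntry _ _ _
  have hcol : ∀ x, x ≠ a → x ≠ c → 1 ≤ (t.symm x).1.2 := by
    intro x hxa hxc
    by_contra hlt
    rcases eq_or_eq_of_column_eq t x one_pos (by omega) with hx | hx
    exacts [hxa hx, hxc hx]
  have hC : columnStabilizer t = {1, swap a c} := by
    ext π
    rw [mem_columnStabilizer, Finset.mem_insert, Finset.mem_singleton]
    refine ⟨fun hπ => ?_, ?_⟩
    · have hfix : ∀ x, x ≠ a → x ≠ c → π x = x := fun x hxa hxc =>
        eq_of_column_eq t x (π x) (hcol x hxa hxc) (hπ x)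
      have hπa : π a = a ∨ π a = c :=
        eq_or_eq_of_column_eq t (π a) one_pos ((hπ a).trans (by simp [ha]))
      have hπc : π c = a ∨ π c = c :=
        eq_or_eq_of_column_eq t (π c) one_pos ((hπ c).trans (by simp [hc]))
      have hne : π a ≠ π c := π.injective.ne hac
      rcases hπa with hπa | hπa <;> rcases hπc with hπc | hπc
      · exact absurd (hπa.trans hπc.symm) hne
      · left
        ext1 x
        by_cases hxa : x = a
        · rw [hxa, hπa]; rfl
        by_cases hxc : x = c
        · rw [hxc, hπc]; rfl
        exact hfix x hxa hxc
      · right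
        ext1 x
        by_cases hxa : x = a
        · rw [hxa, hπa, swap_apply_left]
        by_cases hxc : x = c
        · rw [hxc, hπc, swap_apply_right]
        rw [swap_apply_of_ne_of_ne hxa hxc, hfix x hxa hxc]
      · exact absurd (hπa.trans hπc.symm) hne
    · rintro (rfl | rfl) x
      · rfl
      · exact column_swap t (by simp [ha, hc]) x
  have htab : tabloid t = fun x => if x = c then 1 else 0 := by
    funext x
    rw [tabloid_eq_ite]
    refine if_congr ⟨?_, fun hx => ⟨0, one_pos, hx⟩⟩ rfl rfl
    rintro ⟨j, hj, rfl⟩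
    obtain rfl : j = 0 := by omega
    rfl
  have hne : (1 : Perm (Fin n)) ≠ swap a c := fun h1 =>
    hac (by rw [← swap_apply_left a c, ← h1]; rfl)
  have hterm : ∀ π : Perm (Fin n), Finsupp.single (tabloid (t.trans π)) (1 : ℚ) =
      tabloid₁ (π c) := by
    intro π
    rw [tabloid₁]
    congr 1
    funext x
    rw [tabloid_trans, htab]
    simp [Equiv.symm_apply_eq]
  have hterm' : ∀ (π : Perm (Fin n)) (q : ℚ), Finsupp.single (tabloid (t.trans π)) q =
      q • tabloid₁ (π c) := by
    intro π q
    rw [← hterm, Finsupp.smul_single, smul_eq_mul, mul_one]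
  rw [polytabloid, hC, Finset.sum_pair hne, hterm', hterm', Perm.sign_swap hac]
  simp [sub_eq_add_neg]

/-- Exactly columns 0 and 1 have two cells, so the column group is a Klein four-group; its signed
sum reproduces the alternating 4-cycle of `Omega₄`. -/
theorem polytabloid_two {n : ℕ} {h : 2 * 2 ≤ n} (t : Tableau n (twoRow n 2 h)) :
    polytabloid t =
      tabloid₂ (bottomEntry t 0 two_pos) (bottomEntry t 1 one_lt_two) -
      tabloid₂ (topEntry t 0 (by omega)) (bottomEntry t 1 one_lt_two) -
      tabloid₂ (bottomEntry t 0 two_pos) (topEntry t 1 (by omega)) +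
      tabloid₂ (topEntry t 0 (by omega)) (topEntry t 1 (by omega)) := by
  set c := bottomEntry t 0 two_pos with hc
  set d := bottomEntry t 1 one_lt_two with hd
  set a := topEntry t 0 (by omega) with ha
  set b := topEntry t 1 (by omega) with hb
  have hac : a ≠ c := topEntry_ne_bottomEntry _ _ _
  have had : a ≠ d := topEntry_ne_bottomEntry _ _ _
  have hbc : b ≠ c := topEntry_ne_bottomEntry _ _ _
  have hbd : b ≠ d := topEntry_ne_bottomEntry _ _ _
  have hab : a ≠ b := topEntry_ne_topEntry _ _ _ zero_ne_one
  have hcd : c ≠ d := bottomEntry_ne_bottomEntry _ _ _ zero_ne_one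
  have hcol : ∀ x, x ≠ a → x ≠ c → x ≠ b → x ≠ d → 2 ≤ (t.symm x).1.2 := by
    intro x hxa hxc hxb hxd
    by_contra hlt
    obtain h0 | h1 : (t.symm x).1.2 = 0 ∨ (t.symm x).1.2 = 1 := by omega
    · rcases eq_or_eq_of_column_eq t x two_pos h0 with hx | hx
      exacts [hxa hx, hxc hx]
    · rcases eq_or_eq_of_column_eq t x one_lt_two h1 with hx | hx
      exacts [hxb hx, hxd hx]
  have hC : columnStabilizer t = {1, swap a c, swap b d, swap a c * swap b d} := by
    ext π
    rw [mem_columnStabilizer]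
    simp only [Finset.mem_insert, Finset.mem_singleton]
    refine ⟨fun hπ => ?_, ?_⟩
    · have hfix : ∀ x, x ≠ a → x ≠ c → x ≠ b → x ≠ d → π x = x := fun x hxa hxc hxb hxd =>
        eq_of_column_eq t x (π x) (hcol x hxa hxc hxb hxd) (hπ x)
      have hπa : π a = a ∨ π a = c :=
        eq_or_eq_of_column_eq t (π a) two_pos ((hπ a).trans (by simp [ha]))
      have hπc : π c = a ∨ π c = c :=
        eq_or_eq_of_column_eq t (π c) two_pos ((hπ c).trans (by simp [hc]))
      have hπb : π b = b ∨ π b = d :=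
        eq_or_eq_of_column_eq t (π b) one_lt_two ((hπ b).trans (by simp [hb]))
      have hπd : π d = b ∨ π d = d :=
        eq_or_eq_of_column_eq t (π d) one_lt_two ((hπ d).trans (by simp [hd]))
      have hne : π a ≠ π c := π.injective.ne hac
      have hne' : π b ≠ π d := π.injective.ne hbd
      have hext : ∀ σ : Perm (Fin n), π a = σ a → π b = σ b → π c = σ c → π d = σ d →
          (∀ x, x ≠ a → x ≠ c → x ≠ b → x ≠ d → σ x = x) → π = σ := by
        intro σ h1 h2 h3 h4 h5
        ext1 x
        by_cases hxa : x = a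
        · rw [hxa, h1]
        by_cases hxb : x = b
        · rw [hxb, h2]
        by_cases hxc : x = c
        · rw [hxc, h3]
        by_cases hxd : x = d
        · rw [hxd, h4]
        rw [hfix x hxa hxc hxb hxd, h5 x hxa hxc hxb hxd]
      have hac_or : (π a = a ∧ π c = c) ∨ (π a = c ∧ π c = a) := by
        rcases hπa with h1 | h1 <;> rcases hπc with h2 | h2
        exacts [absurd (h1.trans h2.symm) hne, Or.inl ⟨h1, h2⟩, Or.inr ⟨h1, h2⟩,
          absurd (h1.trans h2.symm) hne]
      have hbd_or : (π b = b ∧ π d = d) ∨ (π b = d ∧ π d = b) := by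
        rcases hπb with h1 | h1 <;> rcases hπd with h2 | h2
        exacts [absurd (h1.trans h2.symm) hne', Or.inl ⟨h1, h2⟩, Or.inr ⟨h1, h2⟩,
          absurd (h1.trans h2.symm) hne']
      rcases hac_or with ⟨h1, h2⟩ | ⟨h1, h2⟩ <;> rcases hbd_or with ⟨h3, h4⟩ | ⟨h3, h4⟩
      · exact Or.inl (hext _ h1 h3 h2 h4 fun _ _ _ _ _ => rfl)
      · refine Or.inr (Or.inr (Or.inl (hext _ ?_ ?_ ?_ ?_ fun x _ _ h5 h6 =>
          swap_apply_of_ne_of_ne h5 h6)))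
        · rw [h1, swap_apply_of_ne_of_ne hab had]
        · rw [h3, swap_apply_left]
        · rw [h2, swap_apply_of_ne_of_ne hbc.symm hcd]
        · rw [h4, swap_apply_right]
      · refine Or.inr (Or.inl (hext _ ?_ ?_ ?_ ?_ fun x h5 h6 _ _ =>
          swap_apply_of_ne_of_ne h5 h6))
        · rw [h1, swap_apply_left]
        · rw [h3, swap_apply_of_ne_of_ne hab.symm hbc]
        · rw [h2, swap_apply_right]
        · rw [h4, swap_apply_of_ne_of_ne had.symm hcd.symm]
      · refine Or.inr (Or.inr (Or.inr (hext _ ?_ ?_ ?_ ?_ fun x h5 h6 h7 h8 => ?_))) <;>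
          rw [Perm.mul_apply]
        · rw [h1, swap_apply_of_ne_of_ne hab had, swap_apply_left]
        · rw [h3, swap_apply_left, swap_apply_of_ne_of_ne had.symm hcd.symm]
        · rw [h2, swap_apply_of_ne_of_ne hbc.symm hcd, swap_apply_right]
        · rw [h4, swap_apply_right, swap_apply_of_ne_of_ne hab.symm hbc]
        · rw [swap_apply_of_ne_of_ne h7 h8, swap_apply_of_ne_of_ne h5 h6]
    · have s1 := column_swap t (a := a) (b := c) (by simp [ha, hc])
      have s2 := column_swap t (a := b) (b := d) (by simp [hb, hd])
      rintro (rfl | rfl | rfl | rfl) x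
      · rfl
      · exact s1 x
      · exact s2 x
      · rw [Perm.mul_apply, s1, s2]
  have htab : tabloid t = fun x => if x = c ∨ x = d then 1 else 0 := by
    funext x
    rw [tabloid_eq_ite]
    refine if_congr ⟨?_, ?_⟩ rfl rfl
    · rintro ⟨j, hj, rfl⟩
      obtain rfl | rfl : j = 0 ∨ j = 1 := by omega
      exacts [Or.inl rfl, Or.inr rfl]
    · rintro (hx | hx)
      exacts [⟨0, two_pos, hx⟩, ⟨1, one_lt_two, hx⟩]
  have hterm : ∀ (π : Perm (Fin n)) (q : ℚ), Finsupp.single (tabloid (t.trans π)) q =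
      q • tabloid₂ (π c) (π d) := by
    intro π q
    rw [tabloid₂, Finsupp.smul_single, smul_eq_mul, mul_one]
    congr 1
    funext x
    rw [tabloid_trans, htab]
    simp [Equiv.symm_apply_eq]
  have hva : swap a c a = c := swap_apply_left a c
  have hvc : swap a c c = a := swap_apply_right a c
  have hvd : swap a c d = d := swap_apply_of_ne_of_ne had.symm hcd.symm
  have hvb : swap a c b = b := swap_apply_of_ne_of_ne hab.symm hbc
  have hua : swap b d a = a := swap_apply_of_ne_of_ne hab had
  have hub : swap b d b = d := swap_apply_left b d
  have huc : swap b d c = c := swap_apply_of_ne_of_ne hbc.symm hcd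
  have hud : swap b d d = b := swap_apply_right b d
  -- The four elements listed for the column group are distinct, so the sum over it has four
  -- separate terms.
  have n1 : (1 : Perm (Fin n)) ∉ ({swap a c, swap b d, swap a c * swap b d} : Finset _) := by
    simp only [Finset.mem_insert, Finset.mem_singleton, not_or]
    refine ⟨fun he => hac ?_, fun he => hbd ?_, fun he => hac ?_⟩
    · simpa [hva] using Perm.congr_fun he a
    · simpa [hub] using Perm.congr_fun he b
    · simpa [hva, hua] using Perm.congr_fun he a
  have n2 : swap a c ∉ ({swap b d, swap a c * swap b d} : Finset _) := by
    simp only [Finset.mem_insert, Finset.mem_singleton, not_or]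
    refine ⟨fun he => hac.symm ?_, fun he => hbd ?_⟩
    · simpa [hva, hua] using Perm.congr_fun he a
    · simpa [hvb, hub, hvd] using Perm.congr_fun he b
  have n3 : swap b d ≠ swap a c * swap b d := fun he => hac (by
    simpa [hva, hua] using Perm.congr_fun he a)
  rw [polytabloid, hC, Finset.sum_insert n1, Finset.sum_insert n2, Finset.sum_pair n3, hterm,
    hterm, hterm, hterm, Perm.sign_mul, Perm.sign_swap hac, Perm.sign_swap hbd, Perm.mul_apply,
    Perm.mul_apply, hud, huc, hvc, hvd, hvb]
  simp
  abel

/-! ### Isomorphisms with Specht modules -/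

theorem nonempty_equiv_of_map_eq {G M N : Type*} [Group G] [AddCommGroup M] [Module ℚ M]
    [AddCommGroup N] [Module ℚ N] {ρ : Representation ℚ G M} {σ : Representation ℚ G N}
    (U : Subrepresentation ρ) (S : Subrepresentation σ) (f : M →ₗ[ℚ] N)
    (hf : ∀ g v, f (ρ g v) = σ g (f v)) (hmap : U.toSubmodule.map f = S.toSubmodule)
    (hinj : ∀ v ∈ U.toSubmodule, f v = 0 → v = 0) :
    Nonempty (U.toRepresentation.Equiv S.toRepresentation) := by
  have hUS : ∀ v ∈ U.toSubmodule, f v ∈ S.toSubmodule := fun v hv => by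
    rw [← hmap]
    exact ⟨v, hv, rfl⟩
  let e : U.toSubmodule ≃ₗ[ℚ] S.toSubmodule := LinearEquiv.ofBijective (f.restrict hUS) <| by
    constructor
    · rw [← LinearMap.ker_eq_bot, LinearMap.ker_eq_bot']
      intro v hv
      exact Subtype.ext (hinj v.1 v.2 (congrArg Subtype.val hv))
    · rintro ⟨s, hs⟩
      rw [← hmap] at hs
      obtain ⟨v, hv, rfl⟩ := hs
      exact ⟨⟨v, hv⟩, rfl⟩
  exact ⟨Representation.Equiv.mk e fun g => LinearMap.ext fun v => Subtype.ext (hf g v.1)⟩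

/-- `w_{ij}` is sent to twice the tabloid with empty second row. -/
def toTabloid₀ (n : ℕ) : A1 n →ₗ[ℚ] (Fin n → ℕ) →₀ ℚ :=
  ((∑ x, LinearMap.proj x) ∘ₗ rowSum n).smulRight (tabloid₀ n)

theorem toTabloid₀_apply {n : ℕ} (v : A1 n) :
    toTabloid₀ n v = (∑ x, rowSum n v x) • tabloid₀ n := by
  simp [toTabloid₀]

theorem toTabloid₀_A1rep {n : ℕ} (π : Perm (Fin n)) (v : A1 n) :
    toTabloid₀ n (A1rep n π v) = rowRep n π (toTabloid₀ n v) := by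
  rw [toTabloid₀_apply, toTabloid₀_apply, map_smul, rowRep_tabloid₀]
  simp only [rowSum_A1rep]
  congr 1
  exact Equiv.sum_comp π⁻¹ _

/-- `w_{ij}` is sent to the sum of the tabloids with second rows `{i}` and `{j}`. -/
def toTabloid₁ (n : ℕ) : A1 n →ₗ[ℚ] (Fin n → ℕ) →₀ ℚ :=
  (∑ x, (LinearMap.proj x).smulRight (tabloid₁ x)) ∘ₗ rowSum n

theorem toTabloid₁_apply {n : ℕ} (v : A1 n) :
    toTabloid₁ n v = ∑ x, rowSum n v x • tabloid₁ x := by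
  simp [toTabloid₁]

theorem toTabloid₁_A1rep {n : ℕ} (π : Perm (Fin n)) (v : A1 n) :
    toTabloid₁ n (A1rep n π v) = rowRep n π (toTabloid₁ n v) := by
  simp only [toTabloid₁_apply, map_sum, map_smul, rowRep_tabloid₁, rowSum_A1rep]
  refine Finset.sum_equiv π⁻¹ (by simp) fun x _ => ?_
  simp

theorem rowSum_eq_zero_of_toTabloid₁_eq_zero {n : ℕ} {v : A1 n} (h : toTabloid₁ n v = 0) :
    rowSum n v = 0 := by
  funext i
  have := DFunLike.congr_fun h fun x => if x = i then 1 else 0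
  have key : ∀ x, (fun y : Fin n => if y = x then 1 else 0) =
      (fun y : Fin n => if y = i then (1 : ℕ) else 0) ↔ x = i := by
    intro x
    refine ⟨fun hx => ?_, fun hx => by rw [hx]⟩
    have := congrFun hx x
    by_contra hne
    simp [hne] at this
  simpa [toTabloid₁_apply, tabloid₁, Finsupp.finsetSum_apply, Finsupp.single_apply, key] using this

/-- `w_{ij}` is sent to the tabloid with second row `{i, j}`. -/
def toTabloid₂ (n : ℕ) : A1 n →ₗ[ℚ] (Fin n → ℕ) →₀ ℚ := A1lift tabloid₂

theorem toTabloid₂_w {n : ℕ} (i j : Fin n) (h : i ≠ j) : toTabloid₂ n (w i j) = tabloid₂ i j :=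
  A1lift_w _ tabloid₂_comm i j h

theorem toTabloid₂_A1rep {n : ℕ} (π : Perm (Fin n)) (v : A1 n) :
    toTabloid₂ n (A1rep n π v) = rowRep n π (toTabloid₂ n v) := by
  have : toTabloid₂ n ∘ₗ A1rep n π = rowRep n π ∘ₗ toTabloid₂ n := by
    refine A1_hom_ext fun i j h => ?_
    simp [toTabloid₂_w, h, rowRep_tabloid₂]
  exact LinearMap.congr_fun this v

theorem toTabloid₂_apply_pair {n : ℕ} (v : A1 n) (x y : Fin n) (h : x ≠ y) :
    toTabloid₂ n v (fun z => if z = x ∨ z = y then 1 else 0) = entry x y v := by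
  have : Finsupp.lapply (fun z => if z = x ∨ z = y then 1 else 0) ∘ₗ toTabloid₂ n =
      entry x y := by
    refine A1_hom_ext fun i j hij => ?_
    rw [LinearMap.comp_apply, toTabloid₂_w i j hij, entry_w x y i j hij, tabloid₂,
      Finsupp.lapply_apply, Finsupp.single_apply]
    refine if_congr ⟨fun hf => ?_, ?_⟩ rfl rfl
    · have hx := congrFun hf x
      have hy := congrFun hf y
      by_cases h1 : x = i <;> by_cases h2 : x = j <;> by_cases h3 : y = i <;>
        by_cases h4 : y = j <;> simp_all
    · rintro (⟨rfl, rfl⟩ | ⟨rfl, rfl⟩)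
      · rfl
      · funext z
        simp only [or_comm]
  exact LinearMap.congr_fun this v

theorem toTabloid₂_eq_zero {n : ℕ} {v : A1 n} (h : toTabloid₂ n v = 0) : v = 0 := by
  refine A1_ext fun x y hxy => ?_
  rw [← toTabloid₂_apply_pair v x y hxy, h, map_zero, Finsupp.zero_apply]

theorem toTabloid₂_Omega₄ {n : ℕ} {i j k l : Fin n} (hik : i ≠ k) (hil : i ≠ l) (hjk : j ≠ k)
    (hjl : j ≠ l) : toTabloid₂ n (Omega₄ i j k l) =
      tabloid₂ i l - tabloid₂ i k + tabloid₂ j k - tabloid₂ j l := by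
  simp [Omega₄, toTabloid₂_w, *]

theorem polytabloid_mem_specht {n : ℕ} {μ : YoungDiagram} (t : Tableau n μ) :
    polytabloid t ∈ (specht n μ).toSubmodule :=
  Submodule.subset_span ⟨t, rfl⟩

theorem specht_le {n : ℕ} {μ : YoungDiagram} {S : Submodule ℚ ((Fin n → ℕ) →₀ ℚ)}
    (h : ∀ t : Tableau n μ, polytabloid t ∈ S) : (specht n μ).toSubmodule ≤ S := by
  refine Submodule.span_le.2 ?_
  rintro _ ⟨t, rfl⟩
  exact h t

theorem isCopyOf_U₀ {n : ℕ} (hn : 2 ≤ n) (h : 2 * 0 ≤ n) : IsCopyOf (U₀ n) (V n 0 h) := by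
  refine ⟨isIrreducible_U₀ hn, ?_⟩
  have hn' : (2 : ℚ) ≤ n := by exact_mod_cast hn
  -- Each of the n(n - 1)/2 generators contributes 2.
  have hO : toTabloid₀ n (Omega n) = (((n : ℚ) - 1) * n) • tabloid₀ n := by
    rw [toTabloid₀_apply, Omega_eq_star, sum_rowSum_star]
    congr 1
    simp only [Finset.sum_const, Finset.card_univ, Fintype.card_fin, nsmul_eq_mul]
    ring
  have hne : ((n : ℚ) - 1) * n ≠ 0 := by
    have : (0 : ℚ) < (n - 1) * n := mul_pos (by linarith) (by linarith)
    exact this.ne'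
  refine nonempty_equiv_of_map_eq _ _ (toTabloid₀ n) toTabloid₀_A1rep (le_antisymm ?_ ?_) ?_
  · rw [← (isBasisOf_B0 hn).2, Submodule.map_span_le]
    rintro _ ⟨_, rfl⟩
    rw [B0, hO]
    obtain ⟨t⟩ := nonempty_tableau h
    rw [← polytabloid_zero t]
    exact Submodule.smul_mem _ _ (polytabloid_mem_specht t)
  · refine specht_le fun t => ?_
    rw [polytabloid_zero]
    refine ⟨(((n : ℚ) - 1) * n)⁻¹ • Omega n,
      Submodule.smul_mem _ _ (Submodule.mem_span_singleton_self _), ?_⟩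
    rw [map_smul, hO, smul_smul, inv_mul_cancel₀ hne, one_smul]
  · intro v hv hv0
    obtain ⟨c, rfl⟩ := Submodule.mem_span_singleton.1 hv
    rw [map_smul, hO, smul_smul, smul_eq_zero] at hv0
    rcases hv0 with hv0 | hv0
    · rw [(mul_eq_zero.1 hv0).resolve_right hne, zero_smul]
    · simp [tabloid₀] at hv0

theorem isCopyOf_U₁ {n : ℕ} (hn : 3 ≤ n) (h : 2 * 1 ≤ n) : IsCopyOf (U₁ n) (V n 1 h) := by
  have : NeZero n := ⟨by omega⟩
  refine ⟨isIrreducible_U₁ hn, ?_⟩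
  have hn' : (3 : ℚ) ≤ n := by exact_mod_cast hn
  have hne : (n : ℚ) - 2 ≠ 0 := by linarith
  -- The factor n - 2 is the eigenvalue of `rowSum` after `star` on vectors of sum zero.
  have hO : ∀ i j : Fin n, toTabloid₁ n (Omega₂ i j) =
      ((n : ℚ) - 2) • (tabloid₁ i - tabloid₁ j) := by
    intro i j
    have hs : ∀ x, rowSum n (star n (Pi.single i 1 - Pi.single j 1)) x =
        (n - 2) * ((if x = i then 1 else 0) - if x = j then 1 else 0) := by
      intro x
      rw [rowSum_star, mem_sumZero.1 (single_sub_single_mem_sumZero i j), add_zero, Pi.sub_apply,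
        Pi.single_apply, Pi.single_apply]
    rw [toTabloid₁_apply, Omega₂_eq_star]
    simp only [hs, mul_smul, ← Finset.smul_sum, sub_smul _ _ (tabloid₁ _),
      Finset.sum_sub_distrib, ite_smul, one_smul, zero_smul, Finset.sum_ite_eq', Finset.mem_univ,
      if_true]
  refine nonempty_equiv_of_map_eq _ _ (toTabloid₁ n) toTabloid₁_A1rep (le_antisymm ?_ ?_) ?_
  · rw [← (isBasisOf_B1 hn).2, Submodule.map_span_le]
    rintro _ ⟨⟨l, hl⟩, rfl⟩
    rw [B1, hO]
    obtain ⟨t⟩ := nonempty_tableau h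
    have hac : topEntry t 0 (by omega) ≠ bottomEntry t 0 one_pos := topEntry_ne_bottomEntry _ _ _
    -- One polytabloid suffices: 2-transitivity moves its pair of entries to (0, l), and the Specht
    -- module is invariant.
    obtain ⟨σ, hσ⟩ := Perm.exists_extending_pair
      ![bottomEntry t 0 one_pos, topEntry t 0 (by omega)] ![0, l]
      (by intro a b; fin_cases a <;> fin_cases b <;> simp [hac, hac.symm])
      (by intro a b; fin_cases a <;> fin_cases b <;> simp [hl, Ne.symm hl])
    have hmem := (specht n (twoRow n 1 h)).apply_mem_toSubmodule σ (polytabloid_mem_specht t)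
    rw [polytabloid_one, map_sub, rowRep_tabloid₁, rowRep_tabloid₁] at hmem
    have h0 : σ (bottomEntry t 0 one_pos) = 0 := hσ 0
    have h1 : σ (topEntry t 0 (by omega)) = l := hσ 1
    rw [h0, h1] at hmem
    exact Submodule.smul_mem _ _ hmem
  · refine specht_le fun t => ?_
    rw [polytabloid_one]
    refine ⟨((n : ℚ) - 2)⁻¹ • Omega₂ (bottomEntry t 0 one_pos) (topEntry t 0 (by omega)),
      Submodule.smul_mem _ _ ?_, ?_⟩
    · rw [Omega₂_eq_star]
      exact ⟨_, single_sub_single_mem_sumZero _ _, rfl⟩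
    · rw [map_smul, hO, smul_smul, inv_mul_cancel₀ hne, one_smul]
  · rintro _ ⟨a, _, rfl⟩ hv0
    rw [eq_zero_of_rowSum_star_eq_zero hn (rowSum_eq_zero_of_toTabloid₁_eq_zero hv0), map_zero]

theorem isCopyOf_U₂ {n : ℕ} (hn : 4 ≤ n) (h : 2 * 2 ≤ n) : IsCopyOf (U₂ n) (V n 2 h) := by
  have : NeZero n := ⟨by omega⟩
  have hn3 : 3 ≤ n := by omega
  refine ⟨isIrreducible_U₂ hn, ?_⟩
  have hpoly : ∀ t : Tableau n (twoRow n 2 h), ∃ f : Fin 4 → Fin n, Function.Injective f ∧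
      polytabloid t = toTabloid₂ n (Omega₄ (f 0) (f 1) (f 2) (f 3)) := by
    intro t
    have hac : topEntry t 0 (by omega) ≠ bottomEntry t 0 two_pos := topEntry_ne_bottomEntry _ _ _
    have had : topEntry t 0 (by omega) ≠ bottomEntry t 1 one_lt_two :=
      topEntry_ne_bottomEntry _ _ _
    have hbc : topEntry t 1 (by omega) ≠ bottomEntry t 0 two_pos := topEntry_ne_bottomEntry _ _ _
    have hbd : topEntry t 1 (by omega) ≠ bottomEntry t 1 one_lt_two :=
      topEntry_ne_bottomEntry _ _ _
    have hab : topEntry t 0 (by omega) ≠ topEntry t 1 (by omega) :=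
      topEntry_ne_topEntry _ _ _ zero_ne_one
    have hcd : bottomEntry t 0 two_pos ≠ bottomEntry t 1 one_lt_two :=
      bottomEntry_ne_bottomEntry _ _ _ zero_ne_one
    -- Each column forms one of the pairs {i, j}, {k, l}; the second is listed top entry first so
    -- that the signs agree.
    refine ⟨![bottomEntry t 0 two_pos, topEntry t 0 (by omega), topEntry t 1 (by omega),
      bottomEntry t 1 one_lt_two],
      injective_vec_four hac.symm hbc.symm hcd hab had hbd, ?_⟩
    refine (polytabloid_two t).trans (Eq.trans ?_ (toTabloid₂_Omega₄ hbc.symm hcd hab had).symm)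
    abel
  refine nonempty_equiv_of_map_eq _ _ (toTabloid₂ n) toTabloid₂_A1rep (le_antisymm ?_ ?_)
    fun v _ => toTabloid₂_eq_zero
  · rw [← (isBasisOf_B2 hn3).2, Submodule.map_span_le]
    rintro _ ⟨s, rfl⟩
    obtain ⟨t⟩ := nonempty_tableau h
    obtain ⟨f, hf, ht⟩ := hpoly t
    obtain ⟨g, hg, hs⟩ := exists_B2_eq_Omega₄ hn3 s
    obtain ⟨σ, hσ⟩ := Perm.exists_extending_pair f g hf hg
    have hmem := (specht n (twoRow n 2 h)).apply_mem_toSubmodule σ (polytabloid_mem_specht t)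
    rw [ht, ← toTabloid₂_A1rep, A1rep_Omega₄, hσ, hσ, hσ, hσ, ← hs] at hmem
    exact hmem
  · refine specht_le fun t => ?_
    obtain ⟨f, hf, ht⟩ := hpoly t
    rw [ht]
    exact ⟨_, rowSum_Omega₄ (hf.ne (by decide)) (hf.ne (by decide)) (hf.ne (by decide))
      (hf.ne (by decide)), rfl⟩

/-! ### Internal direct sums -/

theorem isInternal_of_forall {ι M : Type*} [Fintype ι] [DecidableEq ι] [AddCommGroup M] [Module ℚ M]
    (U : ι → Submodule ℚ M)
    (hindep : ∀ u : ι → M, (∀ i, u i ∈ U i) → ∑ i, u i = 0 → ∀ i, u i = 0)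
    (hspan : ∀ v, ∃ u : ι → M, (∀ i, u i ∈ U i) ∧ ∑ i, u i = v) :
    DirectSum.IsInternal U := by
  rw [DirectSum.isInternal_submodule_iff_iSupIndep_and_iSup_eq_top]
  constructor
  · rw [iSupIndep_iff_finsetSum_eq_zero_imp_eq_zero]
    intro s v hv hsum i hi
    -- A relation supported on s is extended by zero to all indices.
    have h0 := hindep (fun i => if i ∈ s then v i else 0) (fun j => by
      by_cases hj : j ∈ s
      · simpa [hj] using hv j hj
      · simp [hj]) (by simpa [Finset.sum_ite_mem] using hsum) i
    simpa [hi] using h0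
  · rw [eq_top_iff]
    intro v _
    obtain ⟨u, hu, rfl⟩ := hspan v
    exact Submodule.sum_mem _ fun i _ => Submodule.mem_iSup_of_mem i (hu i)

theorem isInternal_U {n : ℕ} (hn : 3 ≤ n) :
    DirectSum.IsInternal fun k => ((![U₀ n, U₁ n, U₂ n] : Fin 3 → _) k).toSubmodule := by
  refine isInternal_of_forall _ (fun u hu hsum => ?_) fun v => ?_
  · rw [Fin.sum_univ_three] at hsum
    obtain ⟨h0, h1, h2⟩ := add_add_eq_zero hn (hu 0) (hu 1) (hu 2) hsum
    intro i
    fin_cases i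
    exacts [h0, h1, h2]
  · obtain ⟨u₀, h₀, u₁, h₁, u₂, h₂, rfl⟩ := exists_add_add_eq hn v
    refine ⟨![u₀, u₁, u₂], fun i => ?_, Fin.sum_univ_three _⟩
    fin_cases i
    exacts [h₀, h₁, h₂]

/-- With three indices there is no position 2 ≤ x < y and none with y ≥ 3, so the coordinates
determining an element of `U₂` form an empty set. -/
theorem U₂_three : (U₂ 3).toSubmodule = ⊥ := by
  rw [Submodule.eq_bot_iff]
  refine fun v hv => eq_zero_of_entry_eq_zero le_rfl hv ?_ ?_
  · intro x y hx hxy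
    have := y.2
    have : (x : ℕ) < y := hxy
    omega
  · intro y hy
    have := y.2
    omega

theorem isInternal_U_three :
    DirectSum.IsInternal fun k => ((![U₀ 3, U₁ 3] : Fin 2 → _) k).toSubmodule := by
  refine isInternal_of_forall _ (fun u hu hsum => ?_) fun v => ?_
  · rw [Fin.sum_univ_two] at hsum
    obtain ⟨h0, h1, -⟩ := add_add_eq_zero le_rfl (hu 0) (hu 1) (Submodule.zero_mem _)
      (by rw [hsum, add_zero])
    intro i
    fin_cases i
    exacts [h0, h1]
  · obtain ⟨u₀, h₀, u₁, h₁, u₂, h₂, rfl⟩ := exists_add_add_eq le_rfl v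
    rw [U₂_three, Submodule.mem_bot] at h₂
    refine ⟨![u₀, u₁], fun i => ?_, ?_⟩
    · fin_cases i
      exacts [h₀, h₁]
    · rw [h₂, add_zero]
      exact Fin.sum_univ_two _

/-- There is only one generator, and it equals `Omega 2`. -/
theorem U₀_two : U₀ 2 = ⊤ := by
  apply Subrepresentation.toSubmodule_injective
  refine eq_top_iff.2 fun v _ => Submodule.mem_span_singleton.2 ⟨entry 0 1 v, ?_⟩
  refine A1_ext fun x y hxy => ?_
  rw [map_smul, Omega_eq_star, entry_star _ _ _ hxy]
  obtain ⟨rfl, rfl⟩ | ⟨rfl, rfl⟩ : x = 0 ∧ y = 1 ∨ x = 1 ∧ y = 0 := by omega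
  · norm_num
  · rw [entry_comm 1 0]
    norm_num

end Arnold

end

/-! ### Assembly of the stable and unstable cases. -/

theorem proposition6p2 :
    -- the isomorphism `A^1(n) ≅ L P_2(n)`, `w_{ij} ↦ {i, j}`
    (∀ n : ℕ, ∃ φ : (Arnold.A1rep n).Equiv (Arnold.LP n 2),
      ∀ (i j : Fin n) (h : i ≠ j),
        φ (Arnold.w i j) = MonoidAlgebra.single (Arnold.pair i j h) 1) ∧
    -- the stable case
    (∀ (n : ℕ) [NeZero n] (hn : 4 ≤ n),
      ∃ U : Fin 3 → Subrepresentation (Arnold.A1rep n),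
        DirectSum.IsInternal (fun k => (U k).toSubmodule) ∧
        Arnold.IsCopyOf (U 0) (Arnold.V n 0 (by omega)) ∧
        Arnold.IsCopyOf (U 1) (Arnold.V n 1 (by omega)) ∧
        Arnold.IsCopyOf (U 2) (Arnold.V n 2 (by omega)) ∧
        Arnold.IsBasisOf (Arnold.B0 n) (U 0).toSubmodule ∧
        Arnold.IsBasisOf (Arnold.B1 n) (U 1).toSubmodule ∧
        Arnold.IsBasisOf (Arnold.B2 n) (U 2).toSubmodule) ∧
    -- the case `n = 2`: `A^1(2) = V_{(2)}`
    (Arnold.IsCopyOf (⊤ : Subrepresentation (Arnold.A1rep 2)) (Arnold.V 2 0 (by omega)) ∧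
      Arnold.IsBasisOf (Arnold.B0 2) ⊤) ∧
    -- the case `n = 3`: `A^1(3) = V_{(3)} ⊕ V_{(2,1)}`
    (∃ U : Fin 2 → Subrepresentation (Arnold.A1rep 3),
      DirectSum.IsInternal (fun k => (U k).toSubmodule) ∧
      Arnold.IsCopyOf (U 0) (Arnold.V 3 0 (by omega)) ∧
      Arnold.IsCopyOf (U 1) (Arnold.V 3 1 (by omega)) ∧
      Arnold.IsBasisOf (Arnold.B0 3) (U 0).toSubmodule ∧
      Arnold.IsBasisOf (Arnold.B1 3) (U 1).toSubmodule) := by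
  refine ⟨Arnold.exists_A1rep_equiv_LP, fun n _ hn => ?_, ⟨?_, ?_⟩, ?_⟩
  · exact ⟨![Arnold.U₀ n, Arnold.U₁ n, Arnold.U₂ n], Arnold.isInternal_U (by omega),
      Arnold.isCopyOf_U₀ (by omega) _, Arnold.isCopyOf_U₁ (by omega) _, Arnold.isCopyOf_U₂ hn _,
      Arnold.isBasisOf_B0 (by omega), Arnold.isBasisOf_B1 (by omega),
      Arnold.isBasisOf_B2 (by omega)⟩
  · rw [← Arnold.U₀_two]
    exact Arnold.isCopyOf_U₀ le_rfl _
  · have h := Arnold.isBasisOf_B0 (n := 2) le_rfl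
    rwa [Arnold.U₀_two] at h
  · exact ⟨![Arnold.U₀ 3, Arnold.U₁ 3], Arnold.isInternal_U_three,
      Arnold.isCopyOf_U₀ (by omega) _, Arnold.isCopyOf_U₁ le_rfl _,
      Arnold.isBasisOf_B0 (by omega), Arnold.isBasisOf_B1 le_rfl⟩
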